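/- All Banach spaces are real, and $c_{00}$ denotes the finitely supported real sequences. For sequences $(v_i)$, $(y_i)$ in Banach spaces and $C<\infty$, we say that $(v_i)$ *$C$-dominates* $(y_i)$ if $\|\sum a_i y_i\|\le C$ for all $(a_i)\in c_{00}$ with $\|\sum a_i v_i\|\le 1$; $(v_i)$ *dominates* $(y_i)$ if it $C$-dominates $(y_i)$ for some $C<\infty$; the two sequences are *equivalent* if each dominates the other. A sequence $(v_i)$ is *basic* if it is a Schauder basis of its closed linear span, *normalized* if $\|v_i\|=1$ for all $i$, and *1-suppression unconditional* if $\|\sum_{i\in A}a_iv_i\|\le\|\sum a_iv_i\|$ for all $(a_i)\in c_{00}$ and $A\subset\mathbb N$. A Banach space $X$ is $U_{(v_i)}$ if there is a constant $C<\infty$ such that every normalized weakly null sequence in $X$ has a subsequence that is $C$-dominated by $(v_i)$. Tsirelson's space $T$ is the completion of $c_{00}$ under the unique norm satisfying $$\|x\|=\max\Bigl(\|x\|_\infty,\ \sup\Bigl\{\tfrac12\sum_{i=1}^n\|E_i x\| : n\in\mathbb N,\ E_1,\dots,E_n\subset\mathbb N \text{ finite},\ n\le E_1<E_2<\dots<E_n\Bigr\}\Bigr),$$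 where $E x$ is the restriction of $x$ to $E$ (and $n\le E_1$ means $n\le\min E_1$, $E<F$ means $\max E<\min F$). Let $(t_i)$ be the unit vector basis of $T$ and $(t_i^*)\subset T^*$ the functionals biorthogonal to $(t_i)$. **Lemma 5.7.** Let $(v_i)$ be a 1-suppression unconditional normalized basic sequence in a Banach space such that for every strictly increasing sequence $(k_i)$ of positive integers $(v_{k_i})$ dominates $(v_i)$, and suppose that $(v_i)$ is not equivalent to the unit vector basis of $c_0$. Then there exists a reflexive Banach space $X$ which is $U_{(v_i)}$ and not $U_{(t_i^*)}$. -/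

import Mathlib

open Filter Topology

namespace UpperEstimate

/-! ### Sequences in Banach spaces

Sequences are indexed by `ℕ = {0, 1, 2, …}`, so the term `v i` is the `(i + 1)`-st term of the
sequence `(v_1, v_2, …)`.  Finitely supported sequences of scalars (`c₀₀`) are elements of `ℕ →₀ ℝ`,
and `Finsupp.linearCombination ℝ v a` is the finite sum `∑ a_i v_i`. -/

section Sequences

variable {V W : Type*} [NormedAddCommGroup V] [NormedSpace ℝ V]
  [NormedAddCommGroup W] [NormedSpace ℝ W]

/-- A basic sequence: a sequence that is a Schauder basis of its closed linear span. -/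
def IsBasicSequence (v : ℕ → V) : Prop :=
  ∃ b : SchauderBasis ℝ (Submodule.span ℝ (Set.range v)).topologicalClosure,
    ∀ i, (b.basis i : V) = v i

/-- All terms have norm one. -/
def IsNormalized (v : ℕ → V) : Prop := ∀ i, ‖v i‖ = 1

/-- `1`-suppression unconditional: `‖∑_{i ∈ A} a_i v_i‖ ≤ ‖∑ a_i v_i‖` for all `A` and all
finitely supported `a`. -/
def IsOneSuppressionUnconditional (v : ℕ → V) : Prop :=
  ∀ (a : ℕ →₀ ℝ) (A : Finset ℕ),
    ‖Finsupp.linearCombination ℝ v (a.filter (· ∈ A))‖ ≤ ‖Finsupp.linearCombination ℝ v a‖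

/-- `v` `C`-dominates `y` (`y` has a `C`-upper `v`-estimate):
`‖∑ a_i y_i‖ ≤ C` for all finitely supported `a` with `‖∑ a_i v_i‖ ≤ 1`. -/
def CDominates (C : ℝ) (v : ℕ → V) (y : ℕ → W) : Prop :=
  ∀ a : ℕ →₀ ℝ, ‖Finsupp.linearCombination ℝ v a‖ ≤ 1 → ‖Finsupp.linearCombination ℝ y a‖ ≤ C

/-- `v` dominates `y`. -/
def Dominates (v : ℕ → V) (y : ℕ → W) : Prop := ∃ C : ℝ, CDominates C v y

/-- Equivalence of sequences: each dominates the other. -/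
def IsEquivalentTo (v : ℕ → V) (y : ℕ → W) : Prop := Dominates v y ∧ Dominates y v

/-- Weak convergence to `0`. -/
def IsWeaklyNull (x : ℕ → V) : Prop :=
  ∀ f : StrongDual ℝ V, Tendsto (fun n => f (x n)) atTop (𝓝 0)

end Sequences

/-- The property `U_{(v_i)}` of the space `X`: there is one constant `C` such that every normalized
weakly null sequence in `X` has a subsequence that is `C`-dominated by `v`. -/
def HasU {V : Type*} [NormedAddCommGroup V] [NormedSpace ℝ V] (v : ℕ → V)
    (X : Type*) [NormedAddCommGroup X] [NormedSpace ℝ X] : Prop :=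
  ∃ C : ℝ, ∀ x : ℕ → X, IsNormalized x → IsWeaklyNull x →
    ∃ k : ℕ → ℕ, StrictMono k ∧ CDominates C v (x ∘ k)

/-- Reflexivity: the canonical embedding into the bidual is onto. -/
def IsReflexiveSpace (X : Type*) [NormedAddCommGroup X] [NormedSpace ℝ X] : Prop :=
  Function.Surjective (NormedSpace.inclusionInDoubleDual ℝ X)

/-- The unit vector basis of `c₀`, the Banach space of null sequences with the supremum norm. -/
noncomputable def c0Basis (i : ℕ) : ZeroAtInftyContinuousMap ℕ ℝ where
  toFun := Pi.single i 1
  continuous_toFun := continuous_of_discreteTopology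
  zero_at_infty' := by
    rw [Filter.cocompact_eq_cofinite]
    refine tendsto_const_nhds.congr' ?_
    have : ({i} : Set ℕ)ᶜ ∈ (Filter.cofinite : Filter ℕ) := (Set.finite_singleton i).compl_mem_cofinite
    filter_upwards [this] with j hj
    exact (Pi.single_eq_of_ne (M := fun _ => ℝ) hj 1).symm

/-! ### Tsirelson's space -/

/-- `n ≤ E_1 < E_2 < … < E_n`.  The index `a : ℕ` stands for the `(a + 1)`-st coordinate,
whence `n ≤ a + 1`.  Empty sets are allowed; they contribute nothing to the sums below. -/
def IsAdmissible (n : ℕ) (E : Fin n → Finset ℕ) : Prop :=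
  (∀ i, ∀ a ∈ E i, n ≤ a + 1) ∧ ∀ i j, i < j → ∀ a ∈ E i, ∀ b ∈ E j, a < b

/-- `N` satisfies Tsirelson's implicit relation
`N x = max (‖x‖_∞) (sup { (1/2) ∑_{i=1}^n N (E_i x) : n ≤ E_1 < … < E_n })` on `c₀₀`, where `E x` is
the restriction of `x` to `E`. -/
def IsTsirelsonNorm (N : (ℕ →₀ ℝ) → ℝ) : Prop :=
  ∀ x : ℕ →₀ ℝ, IsLUB
    (Set.range (fun i => |x i|) ∪
      {r | ∃ (n : ℕ) (E : Fin n → Finset ℕ), IsAdmissible n E ∧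
        r = (1 / 2) * ∑ i, N (x.filter (· ∈ E i))}) (N x)

/-- The `k`-th approximation of Tsirelson's norm. -/
noncomputable def tsirelsonIter : ℕ → (ℕ →₀ ℝ) → ℝ
  | 0, x => ⨆ i, |x i|
  | k + 1, x => max (tsirelsonIter k x)
      (⨆ F : {F : Σ n, (Fin n → Finset ℕ) // IsAdmissible F.1 F.2},
        (1 / 2) * ∑ i, tsirelsonIter k (x.filter (· ∈ F.1.2 i)))

/-- Tsirelson's norm on `c₀₀`, in the construction of Figiel and Johnson.  It is the only solution
of the implicit relation, see `isTsirelsonNorm_tsirelsonNorm` and `IsTsirelsonNorm.unique`. -/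
noncomputable def tsirelsonNorm (x : ℕ →₀ ℝ) : ℝ := ⨆ k, tsirelsonIter k x

lemma bddAbove_coord (x : ℕ →₀ ℝ) : BddAbove (Set.range fun i => |x i|) := by
  refine ⟨∑ i ∈ x.support, |x i|, ?_⟩
  rintro _ ⟨i, rfl⟩
  by_cases h : i ∈ x.support
  · exact Finset.single_le_sum (f := fun i => |x i|) (fun _ _ => abs_nonneg _) h
  · simp only [Finsupp.mem_support_iff, not_not] at h
    simp only [h, abs_zero]
    positivity

lemma sum_l1_filter_le {n : ℕ} {E : Fin n → Finset ℕ} (hE : IsAdmissible n E) (x : ℕ →₀ ℝ) :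
    ∑ i, ∑ a ∈ (x.filter (· ∈ E i)).support, |x.filter (· ∈ E i) a| ≤ ∑ a ∈ x.support, |x a| := by
  have h1 : ∀ i, ∑ a ∈ (x.filter (· ∈ E i)).support, |x.filter (· ∈ E i) a|
      = ∑ a ∈ x.support.filter (· ∈ E i), |x a| := by
    intro i
    rw [Finsupp.support_filter]
    refine Finset.sum_congr rfl fun a ha => ?_
    rw [Finsupp.filter_apply_pos _ _ (Finset.mem_filter.1 ha).2]
  simp_rw [h1]
  rw [← Finset.sum_biUnion]
  · refine Finset.sum_le_sum_of_subset_of_nonneg ?_ fun _ _ _ => abs_nonneg _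
    exact Finset.biUnion_subset.2 fun i _ => Finset.filter_subset _ _
  · intro i _ j _ hij
    rw [Function.onFun, Finset.disjoint_left]
    intro a ha hb
    have ha := (Finset.mem_filter.1 ha).2
    have hb := (Finset.mem_filter.1 hb).2
    rcases lt_or_gt_of_ne hij with h | h
    · exact lt_irrefl _ (hE.2 i j h a ha a hb)
    · exact lt_irrefl _ (hE.2 j i h a hb a ha)

lemma tsirelsonIter_nonneg (k : ℕ) (x : ℕ →₀ ℝ) : 0 ≤ tsirelsonIter k x := by
  induction k with
  | zero => exact Real.iSup_nonneg fun _ => abs_nonneg _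
  | succ k ih => exact le_max_of_le_left ih

lemma tsirelsonIter_le_l1 (k : ℕ) (x : ℕ →₀ ℝ) :
    tsirelsonIter k x ≤ ∑ a ∈ x.support, |x a| := by
  induction k generalizing x with
  | zero =>
    refine ciSup_le fun i => ?_
    by_cases h : i ∈ x.support
    · exact Finset.single_le_sum (f := fun i => |x i|) (fun _ _ => abs_nonneg _) h
    · simp only [Finsupp.mem_support_iff, not_not] at h
      simp only [h, abs_zero]
      positivity
  | succ k ih =>
    refine max_le (ih x) (Real.iSup_le (fun F => ?_) (by positivity))
    have h1 := Finset.sum_le_sum fun i (_ : i ∈ Finset.univ) => ih (x.filter (· ∈ F.1.2 i))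
    have h2 := sum_l1_filter_le F.2 x
    have h3 : 0 ≤ ∑ a ∈ x.support, |x a| := by positivity
    linarith

lemma bddAbove_admissible (k : ℕ) (x : ℕ →₀ ℝ) :
    BddAbove (Set.range fun F : {F : Σ n, (Fin n → Finset ℕ) // IsAdmissible F.1 F.2} =>
      (1 / 2) * ∑ i, tsirelsonIter k (x.filter (· ∈ F.1.2 i))) := by
  refine ⟨∑ a ∈ x.support, |x a|, ?_⟩
  rintro _ ⟨F, rfl⟩
  have h1 := Finset.sum_le_sum
    fun i (_ : i ∈ Finset.univ) => tsirelsonIter_le_l1 k (x.filter (· ∈ F.1.2 i))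
  have h2 := sum_l1_filter_le F.2 x
  have h3 : 0 ≤ ∑ a ∈ x.support, |x a| := by positivity
  dsimp only
  linarith

lemma bddAbove_iter (x : ℕ →₀ ℝ) : BddAbove (Set.range fun k => tsirelsonIter k x) := by
  refine ⟨∑ a ∈ x.support, |x a|, ?_⟩
  rintro _ ⟨k, rfl⟩
  exact tsirelsonIter_le_l1 k x

lemma tsirelsonIter_mono (x : ℕ →₀ ℝ) : Monotone fun k => tsirelsonIter k x :=
  monotone_nat_of_le_succ fun _ => le_max_left _ _

lemma tsirelsonIter_le_norm (k : ℕ) (x : ℕ →₀ ℝ) : tsirelsonIter k x ≤ tsirelsonNorm x :=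
  le_ciSup (bddAbove_iter x) k

lemma tendsto_tsirelsonIter (x : ℕ →₀ ℝ) :
    Tendsto (fun k => tsirelsonIter k x) atTop (𝓝 (tsirelsonNorm x)) :=
  tendsto_atTop_ciSup (tsirelsonIter_mono x) (bddAbove_iter x)

lemma abs_coord_le_tsirelsonNorm (x : ℕ →₀ ℝ) (i : ℕ) : |x i| ≤ tsirelsonNorm x :=
  (le_ciSup (bddAbove_coord x) i).trans (tsirelsonIter_le_norm 0 x)

/-- Tsirelson's norm satisfies the implicit relation. -/
theorem isTsirelsonNorm_tsirelsonNorm : IsTsirelsonNorm tsirelsonNorm := by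
  intro x
  constructor
  · rintro r (⟨i, rfl⟩ | ⟨n, E, hE, rfl⟩)
    · exact abs_coord_le_tsirelsonNorm x i
    · have h : Tendsto (fun k => (1 / 2 : ℝ) * ∑ i, tsirelsonIter k (x.filter (· ∈ E i))) atTop
          (𝓝 ((1 / 2) * ∑ i, tsirelsonNorm (x.filter (· ∈ E i)))) :=
        (tendsto_finsetSum _ fun i _ => tendsto_tsirelsonIter _).const_mul _
      refine le_of_tendsto' h fun k => le_trans ?_ (tsirelsonIter_le_norm (k + 1) x)
      exact le_max_of_le_right (le_ciSup (bddAbove_admissible k x) ⟨⟨n, E⟩, hE⟩)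
  · intro M hM
    have hM0 : 0 ≤ M := (abs_nonneg _).trans (hM (Or.inl ⟨0, rfl⟩))
    refine ciSup_le fun k => ?_
    induction k with
    | zero => exact ciSup_le fun i => hM (Or.inl ⟨i, rfl⟩)
    | succ k ih =>
      refine max_le ih (Real.iSup_le (fun F => ?_) hM0)
      refine le_trans ?_ (hM (Or.inr ⟨F.1.1, F.1.2, F.2, rfl⟩))
      gcongr
      exact tsirelsonIter_le_norm _ _

/-- The implicit relation has at most one solution. -/
theorem IsTsirelsonNorm.unique {N M : (ℕ →₀ ℝ) → ℝ} (hN : IsTsirelsonNorm N)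
    (hM : IsTsirelsonNorm M) : N = M := by
  have nonneg : ∀ {N : (ℕ →₀ ℝ) → ℝ}, IsTsirelsonNorm N → ∀ x, 0 ≤ N x := fun h x =>
    (abs_nonneg _).trans ((h x).1 (Or.inl ⟨0, rfl⟩))
  have zero : ∀ {N : (ℕ →₀ ℝ) → ℝ}, IsTsirelsonNorm N → N 0 = 0 := by
    intro N h
    have h3 := (h 0).1 (Or.inr ⟨3, fun _ => ∅, ⟨by simp, by simp⟩, rfl⟩)
    have h0 := nonneg h 0
    simp only [Finsupp.filter_zero, Finset.sum_const, Finset.card_univ, Fintype.card_fin,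
      nsmul_eq_mul, Nat.cast_ofNat] at h3
    linarith
  have key : ∀ (m : ℕ) (N M : (ℕ →₀ ℝ) → ℝ), IsTsirelsonNorm N → IsTsirelsonNorm M →
      ∀ x : ℕ →₀ ℝ, x.support.card = m → N x ≤ M x := by
    intro m
    induction m using Nat.strong_induction_on with
    | _ m ih =>
    intro N M hN hM x hx
    have hle : N x ≤ max (M x) (N x / 2) := by
      refine (hN x).2 ?_
      rintro r (⟨i, rfl⟩ | ⟨n, E, hE, rfl⟩)
      · exact le_max_of_le_left ((hM x).1 (Or.inl ⟨i, rfl⟩))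
      · by_cases hall : ∀ i, (x.filter (· ∈ E i)).support.card < m
        · refine le_max_of_le_left (le_trans ?_ ((hM x).1 (Or.inr ⟨n, E, hE, rfl⟩)))
          gcongr with i
          exact ih _ (hall i) N M hN hM _ rfl
        · push Not at hall
          obtain ⟨i, hi⟩ := hall
          have hsupp : x.support.filter (· ∈ E i) = x.support :=
            Finset.eq_of_subset_of_card_le (Finset.filter_subset _ _)
              (by rw [hx]; simpa [Finsupp.support_filter] using hi)
          have hmem : ∀ a ∈ x.support, a ∈ E i := fun a ha =>
            (Finset.mem_filter.1 (hsupp.symm ▸ ha : a ∈ x.support.filter (· ∈ E i))).2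
          refine le_max_of_le_right ?_
          rw [Finset.sum_eq_single i]
          · have : x.filter (· ∈ E i) = x := by
              rw [Finsupp.filter_eq_self_iff]
              exact fun a ha => hmem a (Finsupp.mem_support_iff.2 ha)
            rw [this]
            linarith
          · intro j _ hji
            have : x.filter (· ∈ E j) = 0 := by
              rw [Finsupp.filter_eq_zero_iff]
              intro a ha
              by_contra hne
              have hai := hmem a (Finsupp.mem_support_iff.2 hne)
              rcases lt_or_gt_of_ne hji with h | h
              · exact lt_irrefl _ (hE.2 j i h a ha a hai)
              · exact lt_irrefl _ (hE.2 i j h a hai a ha)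
            rw [this, zero hN]
          · simp
    have h0 := nonneg hN x
    rcases le_max_iff.1 hle with h | h
    · exact h
    · linarith [nonneg hM x]
  funext x
  exact le_antisymm (key _ N M hN hM x rfl) (key _ M N hM hN x rfl)

lemma tsirelsonIter_smul (k : ℕ) (c : ℝ) (x : ℕ →₀ ℝ) :
    tsirelsonIter k (c • x) = |c| * tsirelsonIter k x := by
  induction k generalizing x with
  | zero =>
    simp only [tsirelsonIter, Finsupp.smul_apply, smul_eq_mul, abs_mul]
    exact (Real.mul_iSup_of_nonneg (abs_nonneg c) _).symm
  | succ k ih =>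
    simp only [tsirelsonIter, Finsupp.filter_smul, ih]
    rw [mul_max_of_nonneg _ _ (abs_nonneg c), Real.mul_iSup_of_nonneg (abs_nonneg c)]
    congr 2
    funext F
    rw [← Finset.mul_sum]
    ring

lemma tsirelsonIter_add_le (k : ℕ) (x y : ℕ →₀ ℝ) :
    tsirelsonIter k (x + y) ≤ tsirelsonIter k x + tsirelsonIter k y := by
  induction k generalizing x y with
  | zero =>
    refine ciSup_le fun i => (abs_add_le _ _).trans ?_
    exact add_le_add (le_ciSup (bddAbove_coord x) i) (le_ciSup (bddAbove_coord y) i)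
  | succ k ih =>
    refine max_le ((ih x y).trans (add_le_add (le_max_left _ _) (le_max_left _ _))) ?_
    refine Real.iSup_le (fun F => ?_)
      (add_nonneg (tsirelsonIter_nonneg (k + 1) x) (tsirelsonIter_nonneg (k + 1) y))
    have h1 := Finset.sum_le_sum fun i (_ : i ∈ Finset.univ) =>
      ih (x.filter (· ∈ F.1.2 i)) (y.filter (· ∈ F.1.2 i))
    rw [Finset.sum_add_distrib] at h1
    simp only [← Finsupp.filter_add] at h1
    have hx := (le_ciSup (bddAbove_admissible k x) F).trans (le_max_right (tsirelsonIter k x) _)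
    have hy := (le_ciSup (bddAbove_admissible k y) F).trans (le_max_right (tsirelsonIter k y) _)
    simp only [tsirelsonIter]
    linarith

lemma tsirelsonNorm_smul (c : ℝ) (x : ℕ →₀ ℝ) :
    tsirelsonNorm (c • x) = |c| * tsirelsonNorm x := by
  simp only [tsirelsonNorm, tsirelsonIter_smul]
  exact (Real.mul_iSup_of_nonneg (abs_nonneg c) _).symm

lemma tsirelsonNorm_add_le (x y : ℕ →₀ ℝ) :
    tsirelsonNorm (x + y) ≤ tsirelsonNorm x + tsirelsonNorm y :=
  ciSup_le fun k => (tsirelsonIter_add_le k x y).trans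
    (add_le_add (tsirelsonIter_le_norm k x) (tsirelsonIter_le_norm k y))

/-- `c₀₀`, as the carrier of Tsirelson's norm. -/
def TsirelsonPre : Type := ℕ →₀ ℝ

noncomputable instance : AddCommGroup TsirelsonPre := inferInstanceAs (AddCommGroup (ℕ →₀ ℝ))

noncomputable instance : Module ℝ TsirelsonPre := inferInstanceAs (Module ℝ (ℕ →₀ ℝ))

noncomputable instance : Norm TsirelsonPre := ⟨fun x => tsirelsonNorm x⟩

theorem tsirelsonPre_core : NormedSpace.Core ℝ TsirelsonPre where
  norm_nonneg x := (abs_nonneg _).trans (abs_coord_le_tsirelsonNorm x 0)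
  norm_smul c x := tsirelsonNorm_smul c x
  norm_triangle x y := tsirelsonNorm_add_le x y
  norm_eq_zero_iff x := by
    constructor
    · intro h
      refine Finsupp.ext fun i => abs_nonpos_iff.1 ?_
      exact (abs_coord_le_tsirelsonNorm x i).trans h.le
    · rintro rfl
      have h := tsirelsonNorm_smul 0 (0 : ℕ →₀ ℝ)
      rw [zero_smul, abs_zero, zero_mul] at h
      exact h

noncomputable instance : NormedAddCommGroup TsirelsonPre :=
  NormedAddCommGroup.ofCore tsirelsonPre_core

noncomputable instance : NormedSpace ℝ TsirelsonPre := NormedSpace.ofCore tsirelsonPre_core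

/-- Tsirelson's space `T`: the completion of `c₀₀` under Tsirelson's norm. -/
abbrev TsirelsonSpace : Type := UniformSpace.Completion TsirelsonPre

/-- The unit vector basis `(t_i)` of `T`. -/
noncomputable def tsirelsonBasis (i : ℕ) : TsirelsonSpace :=
  UniformSpace.Completion.coe' (α := TsirelsonPre) (Finsupp.single i 1 : ℕ →₀ ℝ)

/-- The coordinate functional `x ↦ x_i` on `c₀₀` with Tsirelson's norm. -/
noncomputable def tsirelsonPreCoord (i : ℕ) : StrongDual ℝ TsirelsonPre :=
  LinearMap.mkContinuous (Finsupp.lapply i : (ℕ →₀ ℝ) →ₗ[ℝ] ℝ) 1 fun x => by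
    rw [one_mul]
    exact abs_coord_le_tsirelsonNorm x i

/-- The functionals `(t_i^*)` biorthogonal to `(t_i)`, a sequence in the dual space `T^*`:
`t_i^*` is the continuous extension of the `i`-th coordinate functional. -/
noncomputable def tsirelsonDualBasis (i : ℕ) : StrongDual ℝ TsirelsonSpace :=
  (tsirelsonPreCoord i).extend (UniformSpace.Completion.toComplL : TsirelsonPre →L[ℝ] TsirelsonSpace)

/-- On `c₀₀` the functional `t_i^*` is the `i`-th coordinate. -/
theorem tsirelsonDualBasis_coe (i : ℕ) (x : ℕ →₀ ℝ) :
    tsirelsonDualBasis i (UniformSpace.Completion.coe' (α := TsirelsonPre) x) = x i :=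
  ContinuousLinearMap.extend_eq (f := tsirelsonPreCoord i)
    (e := (UniformSpace.Completion.toComplL : TsirelsonPre →L[ℝ] TsirelsonSpace))
    UniformSpace.Completion.denseRange_coe
    (UniformSpace.Completion.isUniformInducing_coe TsirelsonPre) x

/-- Biorthogonality of `(t_i)` and `(t_i^*)`. -/
theorem tsirelsonDualBasis_basis (i j : ℕ) :
    tsirelsonDualBasis i (tsirelsonBasis j) = if j = i then 1 else 0 := by
  rw [tsirelsonBasis, tsirelsonDualBasis_coe, Finsupp.single_apply]

end UpperEstimate

/-!
The hypotheses on `(v_i)` say that it has no trace of `c₀`: if arbitrarily long sums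
`∑ i ∈ A, v_i` stayed bounded, a subsequence made of such blocks could not dominate `(v_i)`.
Hence a vector of norm one in the span of `(v_i)` has, for each `j`, at most some number
`M_j` of coordinates larger than `4^{-(j+1)}`.

Let `X` be the dual of the space `E` obtained from `c₀₀` by the mixed Tsirelson norm
`‖x‖ = max (‖x‖_∞) (sup 2^{-(j+1)} ∑_{i ≤ N_j} ‖I_i x‖)`, where `I_1 < I_2 < …` and
`N_j ≥ max (4^j, M_j)`.

* A weakly null sequence in `X` has a subsequence close to a block sequence.  Splitting the
  coefficients into the levels `4^{-(j+1)} < |a_i| ≤ 4^{-j}`, each with at most `M_j ≤ N_j` members,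
  gives the upper `(v_i)` estimate.
* `X` is reflexive.  Functionals on `E` have small tails, because adding to a vector `x` a long
  average of later blocks of norm one gives a vector of norm at most `8 / 5 < 2`.  Functionals on
  `X` have small tails, because `4^j` successive functionals of norm one in `X` have a sum of norm
  at most `2^{j+1}`.
* Sums of `n` unit vectors in `E` have norm `o(n)`, so long sums of their coordinate functionals,
  which are weakly null in `X`, are unbounded.  But sums of `n` functionals `t_i^*` with `i ≥ n`
  have norm at most `2`.
-/

namespace UpperEstimate

section LongBoundedSums

variable {V W : Type*} [NormedAddCommGroup V] [NormedAddCommGroup W] {v : ℕ → V} {w : ℕ → W}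

/-- The sequence `w` has arbitrarily long sums `∑ i ∈ A, w i` of uniformly bounded norm.  This
remnant of the `c₀` basis is what tells `(t_i^*)` apart from `(v_i)`. -/
def HasLongBoundedSums (w : ℕ → W) : Prop :=
  ∃ K : ℝ, ∀ n : ℕ, ∃ A : Finset ℕ, n ≤ A.card ∧ ‖∑ i ∈ A, w i‖ ≤ K

lemma HasLongBoundedSums.of_comp {k : ℕ → ℕ} (hk : Function.Injective k)
    (h : HasLongBoundedSums (w ∘ k)) : HasLongBoundedSums w := by
  obtain ⟨K, hK⟩ := h
  refine ⟨K, fun n => ?_⟩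
  obtain ⟨A, hn, hA⟩ := hK n
  exact ⟨A.map ⟨k, hk⟩, by rwa [Finset.card_map], by simpa [Finset.sum_map] using hA⟩

lemma IsNormalized.norm_sum_le_card (hn : IsNormalized v) (A : Finset ℕ) :
    ‖∑ i ∈ A, v i‖ ≤ A.card :=
  (norm_sum_le_of_le A fun i _ => (hn i).le).trans (by simp)

variable [NormedSpace ℝ V] [NormedSpace ℝ W]

lemma CDominates.norm_sum_le {C ρ : ℝ} (h : CDominates C v w) (hρ : 0 < ρ) {A : Finset ℕ}
    (hA : ‖∑ i ∈ A, v i‖ ≤ ρ) : ‖∑ i ∈ A, w i‖ ≤ C * ρ := by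
  have := h (ρ⁻¹ • ∑ i ∈ A, Finsupp.single i 1)
  simp only [map_smul, map_sum, Finsupp.linearCombination_single, one_smul, norm_smul, norm_inv,
    Real.norm_of_nonneg hρ.le, inv_mul_le_iff₀ hρ, mul_one] at this
  linarith [this hA]

lemma HasLongBoundedSums.of_dominates (hv : HasLongBoundedSums v) (h : Dominates v w) :
    HasLongBoundedSums w := by
  obtain ⟨⟨K, hK⟩, C, hC⟩ := And.intro hv h
  refine ⟨C * (|K| + 1), fun n => (hK n).imp fun A hA => ⟨hA.1, hC.norm_sum_le (by positivity) ?_⟩⟩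
  linarith [hA.2, le_abs_self K]

end LongBoundedSums

section Unconditional

variable {V : Type*} [NormedAddCommGroup V] [NormedSpace ℝ V] {v : ℕ → V}

namespace IsOneSuppressionUnconditional

lemma norm_sum_smul_le (h : IsOneSuppressionUnconditional v) {A B : Finset ℕ} (hAB : A ⊆ B)
    (a : ℕ → ℝ) : ‖∑ i ∈ A, a i • v i‖ ≤ ‖∑ i ∈ B, a i • v i‖ := by
  have hsum (D : Finset ℕ) : Finsupp.linearCombination ℝ v (∑ i ∈ D, Finsupp.single i (a i)) =
      ∑ i ∈ D, a i • v i := by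
    simp only [map_sum, Finsupp.linearCombination_single]
  have hfilter : (∑ i ∈ B, Finsupp.single i (a i)).filter (· ∈ A) =
      ∑ i ∈ A, Finsupp.single i (a i) := by
    rw [Finsupp.filter_sum, ← Finset.sum_subset hAB fun i _ hi => Finsupp.filter_single_of_neg _ hi]
    exact Finset.sum_congr rfl fun i hi => Finsupp.filter_single_of_pos _ hi
  simpa only [hfilter, hsum] using h (∑ i ∈ B, Finsupp.single i (a i)) A

lemma norm_sum_le (h : IsOneSuppressionUnconditional v) {A B : Finset ℕ} (hAB : A ⊆ B) :
    ‖∑ i ∈ A, v i‖ ≤ ‖∑ i ∈ B, v i‖ := by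
  simpa only [one_smul] using h.norm_sum_smul_le hAB fun _ => 1

lemma norm_sum_smul_le_two_mul (h : IsOneSuppressionUnconditional v) {A B : Finset ℕ}
    (hAB : A ⊆ B) {a b : ℕ → ℝ} (hab : ∀ i ∈ A, |b i| ≤ |a i|) :
    ‖∑ i ∈ A, b i • v i‖ ≤ 2 * ‖∑ i ∈ B, a i • v i‖ := by
  obtain ⟨g, hg, hgnorm⟩ := exists_dual_vector'' ℝ (∑ i ∈ A, b i • v i)
  have hsub {D : Finset ℕ} (hD : D ⊆ A) :
      |∑ i ∈ D, a i * g (v i)| ≤ ‖∑ i ∈ B, a i • v i‖ := by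
    have := g.le_of_opNorm_le_of_le hg (h.norm_sum_smul_le (hD.trans hAB) a)
    simpa only [map_sum, map_smul, smul_eq_mul, Real.norm_eq_abs, one_mul] using this
  calc ‖∑ i ∈ A, b i • v i‖ = g (∑ i ∈ A, b i • v i) := hgnorm.symm
    _ = ∑ i ∈ A, b i * g (v i) := by simp only [map_sum, map_smul, smul_eq_mul]
    _ ≤ ∑ i ∈ A, |a i * g (v i)| := by
      refine Finset.sum_le_sum fun i hi => (le_abs_self _).trans ?_
      rw [abs_mul, abs_mul]
      exact mul_le_mul_of_nonneg_right (hab i hi) (abs_nonneg _)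
    _ = ∑ i ∈ A with 0 ≤ a i * g (v i), a i * g (v i) -
        ∑ i ∈ A with ¬ 0 ≤ a i * g (v i), a i * g (v i) := by
      rw [← Finset.sum_filter_add_sum_filter_not A (fun i => 0 ≤ a i * g (v i)), sub_eq_add_neg,
        ← Finset.sum_neg_distrib]
      congr 1 <;> refine Finset.sum_congr rfl fun i hi => ?_
      · exact abs_of_nonneg (Finset.mem_filter.1 hi).2
      · exact abs_of_neg (not_le.1 (Finset.mem_filter.1 hi).2)
    _ ≤ 2 * ‖∑ i ∈ B, a i • v i‖ := by
      have hpos := abs_le.1 (hsub (Finset.filter_subset (fun i => 0 ≤ a i * g (v i)) A))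
      have hneg := abs_le.1 (hsub (Finset.filter_subset (fun i => ¬ 0 ≤ a i * g (v i)) A))
      linarith [hpos.2, hneg.1]

lemma abs_le_norm (h : IsOneSuppressionUnconditional v) (hn : IsNormalized v) (a : ℕ →₀ ℝ)
    (i : ℕ) : |a i| ≤ ‖Finsupp.linearCombination ℝ v a‖ := by
  by_cases hi : i ∈ a.support
  · simpa [norm_smul, hn i, Finsupp.linearCombination_apply, Finsupp.sum] using
      h.norm_sum_smul_le (Finset.singleton_subset_iff.2 hi) a
  · rw [Finsupp.notMem_support_iff.1 hi, abs_zero]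
    exact norm_nonneg _

end IsOneSuppressionUnconditional

lemma linearCombination_c0Basis_apply (a : ℕ →₀ ℝ) (i : ℕ) :
    Finsupp.linearCombination ℝ c0Basis a i = a i := by
  have hbasis (j : ℕ) : c0Basis j i = Finsupp.single j (1 : ℝ) i := by
    rw [Finsupp.single_eq_pi_single]
    rfl
  induction a using Finsupp.induction_linear with
  | zero => simp
  | add f g hf hg => rw [map_add, ZeroAtInftyContinuousMap.add_apply, hf, hg, Finsupp.add_apply]
  | single j c =>
    rw [Finsupp.linearCombination_single, ZeroAtInftyContinuousMap.smul_apply, hbasis,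
      ← Finsupp.smul_apply, Finsupp.smul_single_one]

lemma norm_linearCombination_c0Basis_le_iff {a : ℕ →₀ ℝ} {c : ℝ} (hc : 0 ≤ c) :
    ‖Finsupp.linearCombination ℝ c0Basis a‖ ≤ c ↔ ∀ i, |a i| ≤ c := by
  rw [← ZeroAtInftyContinuousMap.norm_toBCF_eq_norm, BoundedContinuousFunction.norm_le hc]
  exact forall_congr' fun i => by
    rw [ZeroAtInftyContinuousMap.toBCF_apply, linearCombination_c0Basis_apply, Real.norm_eq_abs]

lemma IsOneSuppressionUnconditional.isEquivalentTo_c0Basis (h : IsOneSuppressionUnconditional v)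
    (hn : IsNormalized v) {R : ℝ} (hR : ∀ n, ‖∑ i ∈ Finset.range n, v i‖ ≤ R) :
    IsEquivalentTo v c0Basis := by
  refine ⟨⟨1, fun a ha => ?_⟩, 2 * R, fun a ha => ?_⟩
  · exact (norm_linearCombination_c0Basis_le_iff zero_le_one).2 fun i =>
      (h.abs_le_norm hn a i).trans ha
  · have ha := (norm_linearCombination_c0Basis_le_iff zero_le_one).1 ha
    obtain ⟨n, hn⟩ := a.support.exists_nat_subset_range
    calc ‖Finsupp.linearCombination ℝ v a‖
        ≤ 2 * ‖∑ i ∈ Finset.range n, (1 : ℝ) • v i‖ :=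
          h.norm_sum_smul_le_two_mul hn fun i _ => by simpa using ha i
      _ ≤ 2 * R := by simpa using hR n

lemma exists_strictMono_Ico_subset {q : ℕ → ℕ} (hq : StrictMono q) {A : ℕ → Finset ℕ}
    (hne : ∀ m, (A m).Nonempty) (hA : ∀ m, A m ⊆ Finset.Ico (q m) (q (m + 1))) :
    ∃ k : ℕ → ℕ, StrictMono k ∧ ∀ m, ∃ B : Finset ℕ,
      B.image k = A m ∧ Finset.Ico (q m) (A m).card ⊆ B := by
  have hinf : {a | ∃ m, a ∈ A m}.Infinite := by
    refine Set.infinite_of_forall_exists_gt fun m => ?_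
    obtain ⟨a, ha⟩ := hne (m + 1)
    exact ⟨a, ⟨m + 1, ha⟩, (hq.le_apply (x := m + 1)).trans (Finset.mem_Ico.1 (hA _ ha)).1⟩
  have hk := Nat.nth_strictMono hinf
  have hrange := Nat.range_nth_of_infinite hinf
  set k := Nat.nth fun a => ∃ m, a ∈ A m
  refine ⟨k, hk, fun m => ?_⟩
  obtain ⟨B, hB⟩ : ∃ B : Finset ℕ, B.image k = A m := by
    refine ⟨(A m).preimage k hk.injective.injOn, ?_⟩
    rw [← Finset.coe_inj, Finset.coe_image, Finset.coe_preimage,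
      Set.image_preimage_eq_of_subset (hrange ▸ fun a ha => ⟨m, ha⟩)]
  refine ⟨B, hB, fun i hi => ?_⟩
  obtain ⟨hqi, hiA⟩ := Finset.mem_Ico.1 hi
  by_contra hiB
  obtain ⟨m', hm'⟩ : k i ∈ {a | ∃ m, a ∈ A m} := hrange ▸ Set.mem_range_self i
  have hlt : m < m' := by
    refine lt_of_le_of_ne (Nat.lt_succ_iff.1 (hq.lt_iff_lt.1 ?_)) ?_
    · exact (hqi.trans hk.le_apply).trans_lt (Finset.mem_Ico.1 (hA m' hm')).2
    · rintro rfl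
      obtain ⟨j, hj, hji⟩ := Finset.mem_image.1 (hB ▸ hm' : k i ∈ B.image k)
      exact hiB (hk.injective hji ▸ hj)
  have hBi : B ⊆ Finset.range i := fun j hj => by
    have hj := (Finset.mem_Ico.1 (hA m (hB ▸ Finset.mem_image_of_mem k hj))).2
    have hi := (Finset.mem_Ico.1 (hA m' hm')).1
    exact Finset.mem_range.2 (hk.lt_iff_lt.1 (hj.trans_le ((hq.monotone hlt).trans hi)))
  have hcard := Finset.card_le_card hBi
  rw [Finset.card_range, ← Finset.card_image_of_injective B hk.injective, hB] at hcard
  exact hcard.not_gt hiA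

lemma HasLongBoundedSums.exists_forall_ge (hv : HasLongBoundedSums v)
    (h : IsOneSuppressionUnconditional v) : ∃ K : ℝ, 0 < K ∧ ∀ n p : ℕ, ∃ A : Finset ℕ,
      (∀ i ∈ A, p ≤ i) ∧ n ≤ A.card ∧ ‖∑ i ∈ A, v i‖ ≤ K := by
  obtain ⟨K, hK⟩ := hv
  refine ⟨|K| + 1, by positivity, fun n p => ?_⟩
  obtain ⟨A, hn, hA⟩ := hK (n + p)
  refine ⟨A \ Finset.range p, fun i hi => ?_, ?_, ?_⟩
  · simpa using (Finset.mem_sdiff.1 hi).2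
  · have := Finset.le_card_sdiff (Finset.range p) A
    rw [Finset.card_range] at this
    omega
  · linarith [h.norm_sum_le (Finset.sdiff_subset (s := A) (t := Finset.range p)), le_abs_self K]

lemma IsOneSuppressionUnconditional.norm_sum_range_le (h : IsOneSuppressionUnconditional v)
    (hn : IsNormalized v) {p n : ℕ} {B : Finset ℕ} (hB : Finset.Ico p n ⊆ B) :
    ‖∑ i ∈ Finset.range n, v i‖ ≤ p + ‖∑ i ∈ B, v i‖ := by
  have hsub : Finset.range n ⊆ Finset.range p ∪ Finset.Ico p n := fun i hi => by
    simp only [Finset.mem_union, Finset.mem_range, Finset.mem_Ico] at hi ⊢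
    omega
  have hdisj : Disjoint (Finset.range p) (Finset.Ico p n) :=
    Finset.disjoint_left.2 fun i hi hi' =>
      (Finset.mem_range.1 hi).not_ge (Finset.mem_Ico.1 hi').1
  calc ‖∑ i ∈ Finset.range n, v i‖ ≤ ‖∑ i ∈ Finset.range p ∪ Finset.Ico p n, v i‖ :=
        h.norm_sum_le hsub
    _ ≤ ‖∑ i ∈ Finset.range p, v i‖ + ‖∑ i ∈ Finset.Ico p n, v i‖ := by
        rw [Finset.sum_union hdisj]
        exact norm_add_le _ _
    _ ≤ p + ‖∑ i ∈ B, v i‖ :=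
        add_le_add (by simpa using hn.norm_sum_le_card (Finset.range p)) (h.norm_sum_le hB)

lemma HasLongBoundedSums.exists_lt_norm_sum_range_card (hv : HasLongBoundedSums v)
    (h : IsOneSuppressionUnconditional v) (hn : IsNormalized v)
    (hc0 : ¬ IsEquivalentTo v c0Basis) : ∃ K : ℝ, 0 < K ∧ ∀ p : ℕ, ∃ A : Finset ℕ,
      A.Nonempty ∧ (∀ i ∈ A, p ≤ i) ∧ ‖∑ i ∈ A, v i‖ ≤ K ∧
        p * K + p < ‖∑ i ∈ Finset.range A.card, v i‖ := by
  obtain ⟨K, hK0, hK⟩ := hv.exists_forall_ge h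
  refine ⟨K, hK0, fun p => ?_⟩
  obtain ⟨n, hlt⟩ : ∃ n, p * K + p < ‖∑ i ∈ Finset.range n, v i‖ := by
    by_contra! hle
    exact hc0 (h.isEquivalentTo_c0Basis hn hle)
  obtain ⟨A, hpA, hnA, hA⟩ := hK (n + 1) p
  exact ⟨A, Finset.card_pos.1 (n.succ_pos.trans_le hnA), hpA, hA,
    hlt.trans_le (h.norm_sum_le (Finset.range_mono (n.le_succ.trans hnA)))⟩

/- Choose successive sets `A m`, far out, whose sums are bounded although `∑ i < #(A m), v i` is
huge, and let `k` enumerate their union: all but the first few terms of `∑ i < #(A m), v i` are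
matched with terms of `∑ i ∈ A m, v i`, so `v ∘ k` cannot dominate `v`. -/
lemma IsOneSuppressionUnconditional.not_hasLongBoundedSums (h : IsOneSuppressionUnconditional v)
    (hn : IsNormalized v) (hsub : ∀ k : ℕ → ℕ, StrictMono k → Dominates (v ∘ k) v)
    (hc0 : ¬ IsEquivalentTo v c0Basis) : ¬ HasLongBoundedSums v := by
  intro hv
  obtain ⟨K, hK0, hK⟩ := hv.exists_lt_norm_sum_range_card h hn hc0
  choose A hne hpA hA hlt using hK
  have hAsup (p : ℕ) : A p ⊆ Finset.Ico p ((A p).sup id + 1) := fun i hi =>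
    Finset.mem_Ico.2 ⟨hpA p i hi, Nat.lt_succ_iff.2 (Finset.le_sup (f := id) hi)⟩
  set q : ℕ → ℕ := fun m => (fun p => (A p).sup id + 1)^[m] 0
  have hqsucc (m : ℕ) : q (m + 1) = (A (q m)).sup id + 1 := Function.iterate_succ_apply' _ _ _
  have hq : StrictMono q := strictMono_nat_of_lt_succ fun m => by
    obtain ⟨i, hi⟩ := hne (q m)
    have := Finset.mem_Ico.1 (hAsup _ hi)
    rw [hqsucc]
    exact this.1.trans_lt this.2
  obtain ⟨k, hk, hkA⟩ := exists_strictMono_Ico_subset hq (fun m => hne (q m))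
    fun m => hqsucc m ▸ hAsup (q m)
  obtain ⟨C, hC⟩ := hsub k hk
  obtain ⟨m, hm⟩ := exists_nat_ge C
  obtain ⟨B, hBA, hB⟩ := hkA m
  have hBv : ‖∑ i ∈ B, v i‖ ≤ C * K := by
    refine hC.norm_sum_le hK0 ?_
    simpa only [← hBA, Finset.sum_image hk.injective.injOn, Function.comp_apply] using hA (q m)
  have hCq : C ≤ q m := hm.trans (Nat.cast_le.2 hq.le_apply)
  nlinarith [hlt (q m), h.norm_sum_range_le hn hB]

lemma IsOneSuppressionUnconditional.exists_card_filter_le (h : IsOneSuppressionUnconditional v)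
    (hv : ¬ HasLongBoundedSums v) {ε : ℝ} (hε : 0 < ε) :
    ∃ M : ℕ, ∀ a : ℕ →₀ ℝ, ‖Finsupp.linearCombination ℝ v a‖ ≤ 1 →
      (a.support.filter fun i => ε < |a i|).card ≤ M := by
  simp only [HasLongBoundedSums, not_exists, not_forall, not_and, not_le] at hv
  obtain ⟨M, hM⟩ := hv (2 / ε)
  refine ⟨M, fun a ha => ?_⟩
  by_contra! hcard
  refine (hM _ hcard.le).not_ge ?_
  have hle := h.norm_sum_smul_le_two_mul (a := a) (b := fun _ => ε)
    (Finset.filter_subset (fun i => ε < |a i|) a.support) fun i hi => by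
      rw [abs_of_pos hε]
      exact (Finset.mem_filter.1 hi).2.le
  rw [← Finset.smul_sum, norm_smul, Real.norm_of_nonneg hε.le] at hle
  rw [le_div_iff₀' hε]
  exact hle.trans (by simpa [Finsupp.linearCombination_apply, Finsupp.sum] using ha)

end Unconditional

/-- Successive sets `I 0 < I 1 < I 2 < …` of natural numbers; empty sets are allowed. -/
def IsSuccessive (I : ℕ → Set ℕ) : Prop :=
  ∀ s t, s < t → ∀ a ∈ I s, ∀ b ∈ I t, a < b

namespace IsSuccessive

variable {I : ℕ → Set ℕ}

lemma disjoint (hI : IsSuccessive I) {s t : ℕ} (hst : s ≠ t) : Disjoint (I s) (I t) := by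
  refine Set.disjoint_left.2 fun a hs ht => ?_
  rcases hst.lt_or_gt with h | h
  · exact lt_irrefl a (hI s t h a hs a ht)
  · exact lt_irrefl a (hI t s h a ht a hs)

lemma inter_right (hI : IsSuccessive I) (S : Set ℕ) : IsSuccessive fun i => I i ∩ S :=
  fun s t hst a ha b hb => hI s t hst a ha.1 b hb.1

lemma Ico {m : ℕ → ℕ} (hm : Monotone m) : IsSuccessive fun i => Set.Ico (m i) (m (i + 1)) :=
  fun _ _ hst _ ha _ hb => ha.2.trans_le ((hm hst).trans hb.1)

open scoped Classical in
lemma sum_card_filter_le (hI : IsSuccessive I) (A B : Finset ℕ) :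
    ∑ i ∈ B, ((A.filter (· ∈ I i)).card : ℝ) ≤ A.card := by
  have hdisj : (B : Set ℕ).PairwiseDisjoint fun i => A.filter (· ∈ I i) := fun i _ j _ hij =>
    Finset.disjoint_filter.2 fun _ _ hi => Set.disjoint_left.1 (hI.disjoint hij) hi
  rw [← Nat.cast_sum, ← Finset.card_biUnion hdisj]
  exact_mod_cast Finset.card_le_card (Finset.biUnion_subset.2 fun i _ => Finset.filter_subset _ _)

open scoped Classical in
lemma card_filter_le {J : ℕ → Set ℕ} (hI : IsSuccessive I) (hJ : IsSuccessive J)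
    (B D : Finset ℕ) :
    (D.filter fun b => ∃ s ∈ B, ∃ t ∈ B, s < t ∧
      (I s ∩ J b).Nonempty ∧ (I t ∩ J b).Nonempty).card ≤ B.card := by
  refine Finset.card_le_card_of_forall_subsingleton
    (fun b s => ∃ t, s < t ∧ (I s ∩ J b).Nonempty ∧ (I t ∩ J b).Nonempty) (fun b hb => ?_)
    fun s _ b hb b' hb' => ?_
  · obtain ⟨s, hs, t, -, h⟩ := (Finset.mem_filter.1 hb).2
    exact ⟨s, hs, t, h⟩
  · have hnot : ∀ b b', b < b' → ∀ t, s < t → (I t ∩ J b).Nonempty → ¬ (I s ∩ J b').Nonempty :=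
      fun b b' hbb t hst ⟨p, hpI, hpJ⟩ ⟨q, hqI, hqJ⟩ =>
        lt_asymm (hI s t hst q hqI p hpI) (hJ b b' hbb p hpJ q hqJ)
    obtain ⟨-, t, hst, hs, ht⟩ := hb
    obtain ⟨-, t', hst', hs', ht'⟩ := hb'
    rcases lt_trichotomy b b' with h | h | h
    · exact absurd hs' (hnot b b' h t hst ht)
    · exact h
    · exact absurd hs (hnot b' b h t' hst' ht')

end IsSuccessive

/-- The restriction of a finitely supported sequence to a set of coordinates. -/
noncomputable def restrict (S : Set ℕ) : (ℕ →₀ ℝ) →ₗ[ℝ] ℕ →₀ ℝ :=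
  open scoped Classical in
  (Finsupp.supported ℝ ℝ S).subtype ∘ₗ Finsupp.restrictDom ℝ ℝ S

lemma restrict_apply (S : Set ℕ) (x : ℕ →₀ ℝ) (i : ℕ) : restrict S x i = S.indicator x i := by
  classical
  exact Finsupp.filter_apply (· ∈ S) x i

lemma restrict_restrict (S T : Set ℕ) (x : ℕ →₀ ℝ) :
    restrict S (restrict T x) = restrict (S ∩ T) x := by
  ext i
  simp only [restrict_apply, funext (restrict_apply T x), Set.indicator_indicator]

lemma support_restrict_subset (S : Set ℕ) (x : ℕ →₀ ℝ) : (restrict S x).support ⊆ x.support :=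
  fun i hi => by
    rw [Finsupp.mem_support_iff, restrict_apply] at hi
    exact Finsupp.mem_support_iff.2 (Set.indicator_apply_ne_zero.1 hi).2

lemma IsSuccessive.sum_sum_abs_restrict_le {I : ℕ → Set ℕ} (hI : IsSuccessive I) (B D : Finset ℕ)
    (x : ℕ →₀ ℝ) : ∑ i ∈ B, ∑ a ∈ D, |restrict (I i) x a| ≤ ∑ a ∈ D, |x a| := by
  rw [Finset.sum_comm]
  refine Finset.sum_le_sum fun a _ => ?_
  calc ∑ i ∈ B, |restrict (I i) x a| = ∑ i ∈ B, (I i).indicator (fun a => |x a|) a := by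
        simp only [restrict_apply, ← Real.norm_eq_abs, norm_indicator_eq_indicator_norm]
    _ = (⋃ i ∈ B, I i).indicator (fun a => |x a|) a :=
        (Finset.indicator_biUnion_apply B I (fun _ _ _ _ h => hI.disjoint h) a).symm
    _ ≤ |x a| := Set.indicator_le_self' (fun _ _ => abs_nonneg _) a

/-- The norming set of a mixed Tsirelson norm: the least set of functionals on `c₀₀` that contains
the coordinates and all averages `2^{-(j+1)} ∑_{i ∈ B} c_i φ_i ∘ I_i` of its elements, where `B` has
at most `N j` elements, the sets `I_i` are successive and `|c_i| ≤ 1`. -/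
inductive IsNorming (N : ℕ → ℕ) : Module.Dual ℝ (ℕ →₀ ℝ) → Prop
  | coord (i : ℕ) : IsNorming N (Finsupp.lapply i)
  | average {j : ℕ} {B : Finset ℕ} {I : ℕ → Set ℕ} {c : ℕ → ℝ}
      {φ : ℕ → Module.Dual ℝ (ℕ →₀ ℝ)} (hB : B.card ≤ N j) (hI : IsSuccessive I)
      (hc : ∀ i, |c i| ≤ 1) (hφ : ∀ i, IsNorming N (φ i)) :
      IsNorming N ((1 / 2 : ℝ) ^ (j + 1) • ∑ i ∈ B, c i • φ i ∘ₗ restrict (I i))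

lemma exists_half_pow_mul_le (c : ℝ) {ε : ℝ} (hε : 0 < ε) : ∃ m : ℕ, (1 / 2) ^ m * c ≤ ε := by
  have h := (tendsto_pow_atTop_nhds_zero_of_lt_one (r := (1 / 2 : ℝ)) (by norm_num)
    (by norm_num)).mul_const c
  rw [zero_mul] at h
  exact (h.eventually_le_const hε).exists

lemma half_pow_mul_le {r : ℝ} (hr : 0 ≤ r) (j : ℕ) : (1 / 2 : ℝ) ^ j * r ≤ r :=
  mul_le_of_le_one_left hr (pow_le_one₀ (by norm_num) (by norm_num))

lemma abs_average_apply_le {j : ℕ} {B : Finset ℕ} {I : ℕ → Set ℕ} {c : ℕ → ℝ}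
    (φ : ℕ → Module.Dual ℝ (ℕ →₀ ℝ)) (hc : ∀ i, |c i| ≤ 1) (x : ℕ →₀ ℝ) :
    |((1 / 2 : ℝ) ^ j • ∑ i ∈ B, c i • φ i ∘ₗ restrict (I i)) x| ≤
      (1 / 2) ^ j * ∑ i ∈ B, |φ i (restrict (I i) x)| := by
  simp only [LinearMap.smul_apply, LinearMap.sum_apply, LinearMap.comp_apply, smul_eq_mul, abs_mul,
    abs_of_pos (by positivity : (0 : ℝ) < (1 / 2) ^ j)]
  gcongr
  refine (Finset.abs_sum_le_sum_abs _ _).trans (Finset.sum_le_sum fun i _ => ?_)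
  rw [abs_mul]
  exact mul_le_of_le_one_left (abs_nonneg _) (hc i)

namespace IsNorming

variable {N : ℕ → ℕ} {φ : Module.Dual ℝ (ℕ →₀ ℝ)}

lemma abs_apply_le_sum (hφ : IsNorming N φ) (x : ℕ →₀ ℝ) {D : Finset ℕ} (hD : x.support ⊆ D) :
    |φ x| ≤ ∑ a ∈ D, |x a| := by
  induction hφ generalizing x with
  | coord i =>
    by_cases hi : i ∈ D
    · exact Finset.single_le_sum (f := fun a => |x a|) (fun _ _ => abs_nonneg _) hi
    · rw [Finsupp.lapply_apply, Finsupp.notMem_support_iff.1 fun h => hi (hD h), abs_zero]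
      positivity
  | @average j B I c φ _ hI hc _ ih =>
    calc _ ≤ (1 / 2) ^ (j + 1) * ∑ i ∈ B, |φ i (restrict (I i) x)| := abs_average_apply_le φ hc x
      _ ≤ ∑ i ∈ B, |φ i (restrict (I i) x)| := half_pow_mul_le (by positivity) _
      _ ≤ ∑ i ∈ B, ∑ a ∈ D, |restrict (I i) x a| :=
        Finset.sum_le_sum fun i _ => ih i _ ((support_restrict_subset _ x).trans hD)
      _ ≤ ∑ a ∈ D, |x a| := hI.sum_sum_abs_restrict_le B D x

lemma comp_restrict (hφ : IsNorming N φ) (S : Set ℕ) :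
    φ ∘ₗ restrict S = 0 ∨ IsNorming N (φ ∘ₗ restrict S) := by
  cases hφ with
  | coord i =>
    by_cases hi : i ∈ S
    · refine .inr ?_
      convert IsNorming.coord i using 1
      exact LinearMap.ext fun x => by
        simp only [LinearMap.comp_apply, Finsupp.lapply_apply, restrict_apply,
          Set.indicator_of_mem hi]
    · exact .inl <| LinearMap.ext fun x => by
        simp only [LinearMap.comp_apply, Finsupp.lapply_apply, restrict_apply,
          Set.indicator_of_notMem hi, LinearMap.zero_apply]
  | average hB hI hc hφ =>
    refine .inr ?_
    convert IsNorming.average hB (hI.inter_right S) hc hφ using 1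
    exact LinearMap.ext fun x => by
      simp only [LinearMap.comp_apply, LinearMap.smul_apply, LinearMap.sum_apply,
        restrict_restrict]

end IsNorming

section Seminorm

variable (N : ℕ → ℕ)

/-- The mixed Tsirelson norm on `c₀₀` given by the norming set `IsNorming N`, that is,
`‖x‖ = max (‖x‖_∞) (sup { 2^{-(j+1)} ∑_{i ∈ B} ‖I_i x‖ : |B| ≤ N j, (I_i) successive })`. -/
noncomputable def mixedSeminorm : Seminorm ℝ (ℕ →₀ ℝ) :=
  ⨆ φ : {φ // IsNorming N φ}, φ.1.toSeminorm

lemma bddAbove_range_isNorming (x : ℕ →₀ ℝ) :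
    BddAbove (Set.range fun φ : {φ // IsNorming N φ} => φ.1.toSeminorm x) :=
  ⟨∑ a ∈ x.support, |x a|, Set.forall_mem_range.2 fun φ => φ.2.abs_apply_le_sum x subset_rfl⟩

lemma mixedSeminorm_apply (x : ℕ →₀ ℝ) :
    mixedSeminorm N x = ⨆ φ : {φ // IsNorming N φ}, φ.1.toSeminorm x :=
  Seminorm.iSup_apply (Seminorm.bddAbove_range_iff.2 (bddAbove_range_isNorming N))

variable {N} {x : ℕ →₀ ℝ}

lemma IsNorming.abs_apply_le {φ : Module.Dual ℝ (ℕ →₀ ℝ)} (hφ : IsNorming N φ) (x : ℕ →₀ ℝ) :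
    |φ x| ≤ mixedSeminorm N x := by
  rw [mixedSeminorm_apply]
  exact le_ciSup (bddAbove_range_isNorming N x) ⟨φ, hφ⟩

lemma exists_isNorming_lt {r : ℝ} (hr : r < mixedSeminorm N x) :
    ∃ φ, IsNorming N φ ∧ r < |φ x| := by
  have : Nonempty {φ // IsNorming N φ} := ⟨_, .coord 0⟩
  rw [mixedSeminorm_apply] at hr
  obtain ⟨φ, hφ⟩ := exists_lt_of_lt_ciSup hr
  exact ⟨φ, φ.2, hφ⟩

lemma mixedSeminorm_le {M : ℝ} (h : ∀ φ, IsNorming N φ → |φ x| ≤ M) : mixedSeminorm N x ≤ M := by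
  by_contra! hM
  obtain ⟨φ, hφ, hlt⟩ := exists_isNorming_lt hM
  exact hlt.not_ge (h φ hφ)

lemma mixedSeminorm_le_sum (x : ℕ →₀ ℝ) {D : Finset ℕ} (hD : x.support ⊆ D) :
    mixedSeminorm N x ≤ ∑ a ∈ D, |x a| :=
  mixedSeminorm_le fun _ hφ => hφ.abs_apply_le_sum x hD

lemma mixedSeminorm_restrict_le (S : Set ℕ) (x : ℕ →₀ ℝ) :
    mixedSeminorm N (restrict S x) ≤ mixedSeminorm N x := by
  refine mixedSeminorm_le fun φ hφ => ?_
  rw [← LinearMap.comp_apply]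
  rcases hφ.comp_restrict S with h | h
  · rw [h, LinearMap.zero_apply, abs_zero]
    exact apply_nonneg _ _
  · exact h.abs_apply_le x

lemma IsSuccessive.half_pow_mul_sum_mixedSeminorm_le {I : ℕ → Set ℕ} (hI : IsSuccessive I) {j : ℕ}
    {B : Finset ℕ} (hB : B.card ≤ N j) (x : ℕ →₀ ℝ) :
    (1 / 2) ^ (j + 1) * ∑ i ∈ B, mixedSeminorm N (restrict (I i) x) ≤ mixedSeminorm N x := by
  refine le_of_forall_pos_le_add fun ε hε => ?_
  choose φ hφ hlt using fun i => exists_isNorming_lt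
    (sub_lt_self (mixedSeminorm N (restrict (I i) x)) (by positivity : 0 < ε / (B.card + 1)))
  let c : ℕ → ℝ := fun i => SignType.sign (φ i (restrict (I i) x))
  have hc (i : ℕ) : |c i| ≤ 1 := by
    rcases SignType.trichotomy (SignType.sign (φ i (restrict (I i) x))) with h | h | h <;>
      simp [c, h]
  have hsum : (1 / 2) ^ (j + 1) * ∑ i ∈ B, |φ i (restrict (I i) x)| ≤ mixedSeminorm N x := by
    refine le_trans (le_of_eq ?_)
      ((le_abs_self _).trans ((IsNorming.average hB hI hc hφ).abs_apply_le x))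
    simp only [c, LinearMap.smul_apply, LinearMap.sum_apply, LinearMap.comp_apply, smul_eq_mul,
      sign_mul_self]
  calc (1 / 2) ^ (j + 1) * ∑ i ∈ B, mixedSeminorm N (restrict (I i) x)
      ≤ (1 / 2) ^ (j + 1) * ∑ i ∈ B, (|φ i (restrict (I i) x)| + ε / (B.card + 1)) := by
        gcongr with i
        exact (sub_lt_iff_lt_add.1 (hlt i)).le
    _ = (1 / 2) ^ (j + 1) * ∑ i ∈ B, |φ i (restrict (I i) x)| +
        (1 / 2) ^ (j + 1) * (B.card / (B.card + 1) * ε) := by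
        rw [Finset.sum_add_distrib, mul_add, Finset.sum_const, nsmul_eq_mul, mul_div_assoc',
          div_mul_eq_mul_div]
    _ ≤ mixedSeminorm N x + ε := by
        refine add_le_add hsum ((half_pow_mul_le (by positivity) _).trans ?_)
        exact mul_le_of_le_one_left hε.le (div_le_one_of_le₀ (by linarith) (by positivity))

lemma mixedSeminorm_le_max {M : ℝ} (h0 : ∀ i, |x i| ≤ M)
    (h1 : ∀ (j : ℕ) (B : Finset ℕ) (I : ℕ → Set ℕ), B.card ≤ N j → IsSuccessive I →
      (1 / 2) ^ (j + 1) * ∑ i ∈ B, mixedSeminorm N (restrict (I i) x) ≤ M) :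
    mixedSeminorm N x ≤ M := by
  refine mixedSeminorm_le fun φ hφ => ?_
  cases hφ with
  | coord i => exact h0 i
  | average hB hI hc hφ =>
    refine (abs_average_apply_le _ hc x).trans (le_trans ?_ (h1 _ _ _ hB hI))
    gcongr with i
    exact (hφ i).abs_apply_le _

end Seminorm

/-- `c₀₀`, as the carrier of the mixed Tsirelson norm. -/
def MixedPre (_N : ℕ → ℕ) : Type := ℕ →₀ ℝ

namespace MixedPre

variable (N : ℕ → ℕ)

noncomputable instance : AddCommGroup (MixedPre N) := inferInstanceAs (AddCommGroup (ℕ →₀ ℝ))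

noncomputable instance : Module ℝ (MixedPre N) := inferInstanceAs (Module ℝ (ℕ →₀ ℝ))

noncomputable instance : Norm (MixedPre N) := ⟨mixedSeminorm N⟩

lemma normedSpaceCore : NormedSpace.Core ℝ (MixedPre N) where
  norm_nonneg := apply_nonneg (mixedSeminorm N)
  norm_smul := map_smul_eq_mul (mixedSeminorm N)
  norm_triangle := map_add_le_add (mixedSeminorm N)
  norm_eq_zero_iff x :=
    ⟨fun h => Finsupp.ext fun i =>
      abs_nonpos_iff.1 (((IsNorming.coord i).abs_apply_le x).trans (le_of_eq h)),
    fun h => h ▸ map_zero (mixedSeminorm N)⟩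

noncomputable instance : NormedAddCommGroup (MixedPre N) :=
  NormedAddCommGroup.ofCore (normedSpaceCore N)

noncomputable instance : NormedSpace ℝ (MixedPre N) := NormedSpace.ofCore (normedSpaceCore N)

/-- The unit vector `e_i`. -/
noncomputable def unit (i : ℕ) : MixedPre N := (Finsupp.single i 1 : ℕ →₀ ℝ)

/-- The coordinate functional `e_i^*`. -/
noncomputable def coord (i : ℕ) : StrongDual ℝ (MixedPre N) :=
  LinearMap.mkContinuous (Finsupp.lapply i : (ℕ →₀ ℝ) →ₗ[ℝ] ℝ) 1 fun x => by
    rw [one_mul]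
    exact (IsNorming.coord i).abs_apply_le x

/-- The coordinate projection onto a set of coordinates. -/
noncomputable def proj (S : Set ℕ) : MixedPre N →L[ℝ] MixedPre N :=
  LinearMap.mkContinuous (restrict S) 1 fun x => by
    rw [one_mul]
    exact mixedSeminorm_restrict_le S x

variable {N}

lemma ext_coord {x y : MixedPre N} (h : ∀ i, coord N i x = coord N i y) : x = y :=
  Finsupp.ext h

lemma abs_coord_le (i : ℕ) (x : MixedPre N) : |coord N i x| ≤ ‖x‖ :=
  (IsNorming.coord i).abs_apply_le x

lemma coord_proj (i : ℕ) (S : Set ℕ) (x : MixedPre N) :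
    coord N i (proj N S x) = S.indicator (fun i => coord N i x) i :=
  restrict_apply S x i

lemma coord_unit (i j : ℕ) : coord N i (unit N j) = if j = i then 1 else 0 :=
  Finsupp.single_apply

lemma proj_proj (S T : Set ℕ) (x : MixedPre N) : proj N S (proj N T x) = proj N (S ∩ T) x :=
  restrict_restrict S T x

lemma norm_proj_apply_le (S : Set ℕ) (x : MixedPre N) : ‖proj N S x‖ ≤ ‖x‖ :=
  mixedSeminorm_restrict_le S x

lemma norm_comp_proj_le (f : StrongDual ℝ (MixedPre N)) (S : Set ℕ) :
    ‖f.comp (proj N S)‖ ≤ ‖f‖ :=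
  f.comp (proj N S) |>.opNorm_le_bound (norm_nonneg f) fun x =>
    f.le_opNorm_of_le (norm_proj_apply_le S x)

lemma norm_unit (i : ℕ) : ‖unit N i‖ = 1 := by
  refine le_antisymm ?_ ?_
  · refine (mixedSeminorm_le_sum _ Finsupp.support_single_subset).trans ?_
    rw [Finset.sum_singleton, Finsupp.single_eq_same, abs_one]
  · simpa [coord_unit] using abs_coord_le i (unit N i)

lemma norm_coord (i : ℕ) : ‖coord N i‖ = 1 := by
  refine le_antisymm ((coord N i).opNorm_le_bound zero_le_one fun x => ?_) ?_
  · rw [one_mul]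
    exact abs_coord_le i x
  · simpa [coord_unit, norm_unit] using (coord N i).le_opNorm (unit N i)

lemma half_pow_mul_sum_norm_proj_le {j : ℕ} {B : Finset ℕ} {I : ℕ → Set ℕ} (hB : B.card ≤ N j)
    (hI : IsSuccessive I) (x : MixedPre N) :
    (1 / 2) ^ (j + 1) * ∑ i ∈ B, ‖proj N (I i) x‖ ≤ ‖x‖ :=
  hI.half_pow_mul_sum_mixedSeminorm_le hB x

lemma sum_norm_proj_le {j : ℕ} {B : Finset ℕ} {I : ℕ → Set ℕ} (hB : B.card ≤ N j)
    (hI : IsSuccessive I) (x : MixedPre N) :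
    ∑ i ∈ B, ‖proj N (I i) x‖ ≤ 2 ^ (j + 1) * ‖x‖ := by
  rw [← inv_mul_le_iff₀ (by positivity), ← inv_pow, ← one_div]
  exact half_pow_mul_sum_norm_proj_le hB hI x

lemma norm_le_of_average_le {x : MixedPre N} {M : ℝ} (h0 : ∀ i, |coord N i x| ≤ M)
    (h1 : ∀ (j : ℕ) (B : Finset ℕ) (I : ℕ → Set ℕ), B.card ≤ N j → IsSuccessive I →
      (1 / 2) ^ (j + 1) * ∑ i ∈ B, ‖proj N (I i) x‖ ≤ M) : ‖x‖ ≤ M :=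
  mixedSeminorm_le_max h0 h1

lemma exists_sum_norm_proj_le (x : MixedPre N) : ∃ c : ℝ, ∀ (B : Finset ℕ) (I : ℕ → Set ℕ),
    IsSuccessive I → ∑ i ∈ B, ‖proj N (I i) x‖ ≤ c := by
  let D := Finsupp.support (show ℕ →₀ ℝ from x)
  refine ⟨∑ a ∈ D, |coord N a x|, fun B I hI => le_trans ?_
    (hI.sum_sum_abs_restrict_le B D x)⟩
  exact Finset.sum_le_sum fun i _ => mixedSeminorm_le_sum _ (support_restrict_subset _ x)

lemma exists_coord_eq_zero (x : MixedPre N) : ∃ m, ∀ i, m ≤ i → coord N i x = 0 := by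
  obtain ⟨m, hm⟩ := (Finsupp.support (show ℕ →₀ ℝ from x)).exists_nat_subset_range
  exact ⟨m, fun i hi => Finsupp.notMem_support_iff.1 fun h =>
    (Finset.mem_range.1 (hm h)).not_ge hi⟩

end MixedPre

section GlidingHump

variable {E : Type*} [NormedAddCommGroup E] [NormedSpace ℝ E]

lemma exists_lt_apply_of_lt_norm {f : StrongDual ℝ E} {δ : ℝ} (h : δ < ‖f‖) :
    ∃ x, ‖x‖ ≤ 1 ∧ δ < f x := by
  obtain ⟨x, hx1, hx⟩ := f.exists_lt_apply_of_lt_opNorm h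
  rcases lt_abs.1 hx with h | h
  · exact ⟨x, hx1.le, h⟩
  · exact ⟨-x, (norm_neg x).trans_le hx1.le, by rwa [map_neg]⟩

lemma exists_gliding_hump {T : ℕ → E →L[ℝ] E} (hT : ∀ x, Tendsto (fun n => T n x) atTop (𝓝 0))
    {f : StrongDual ℝ E} {δ : ℝ} (hf : ∀ n, δ < ‖f.comp (T n)‖) (n₀ : ℕ) :
    ∃ (x : ℕ → E) (m : ℕ → ℕ), StrictMono m ∧ m 0 = n₀ ∧
      ∀ i, ‖x i‖ ≤ 1 ∧ δ < f (T (m i) (x i) - T (m (i + 1)) (x i)) := by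
  have hstep (n : ℕ) : ∃ x p, ‖x‖ ≤ 1 ∧ n < p ∧ δ < f (T n x - T p x) := by
    obtain ⟨x, hx1, hx⟩ := exists_lt_apply_of_lt_norm (hf n)
    have hlim : Tendsto (fun p => f (T n x - T p x)) atTop (𝓝 (f (T n x))) := by
      simpa only [map_sub, map_zero, sub_zero, Function.comp_apply] using
        ((f.continuous.tendsto 0).comp (hT x)).const_sub (f (T n x))
    obtain ⟨p, hp, hnp⟩ := ((hlim.eventually_const_lt hx).and (eventually_gt_atTop n)).exists
    exact ⟨x, p, hx1, hnp, hp⟩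
  choose x p hx hp hlt using hstep
  have hsucc (i : ℕ) : p^[i + 1] n₀ = p (p^[i] n₀) := Function.iterate_succ_apply' p i n₀
  refine ⟨fun i => x (p^[i] n₀), fun i => p^[i] n₀, strictMono_nat_of_lt_succ fun i => ?_, rfl,
    fun i => ⟨hx _, ?_⟩⟩
  · exact hsucc i ▸ hp _
  · simpa only [hsucc] using hlt _

lemma tendsto_norm_comp_zero {T : ℕ → E →L[ℝ] E} (hT : ∀ n, ‖T n‖ ≤ 1)
    (hTT : ∀ m n, m ≤ n → (T m).comp (T n) = T n) {f : StrongDual ℝ E} {q : ℝ} (hq : q < 1)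
    (h : ∀ δ, (∀ n, δ < ‖f.comp (T n)‖) → ∀ n, δ ≤ q * ‖f.comp (T n)‖) :
    Tendsto (fun n => ‖f.comp (T n)‖) atTop (𝓝 0) := by
  have hanti : Antitone fun n => ‖f.comp (T n)‖ := fun m n hmn => by
    calc ‖f.comp (T n)‖ = ‖(f.comp (T m)).comp (T n)‖ := by
          rw [ContinuousLinearMap.comp_assoc, hTT m n hmn]
      _ ≤ ‖f.comp (T m)‖ * ‖T n‖ := (f.comp (T m)).opNorm_comp_le (T n)
      _ ≤ ‖f.comp (T m)‖ := mul_le_of_le_one_right (norm_nonneg (f.comp (T m))) (hT n)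
  have hbdd : BddBelow (Set.range fun n => ‖f.comp (T n)‖) :=
    ⟨0, Set.forall_mem_range.2 fun n => norm_nonneg (f.comp (T n))⟩
  have hlim := tendsto_atTop_ciInf hanti hbdd
  set L := ⨅ n, ‖f.comp (T n)‖
  have hL0 : 0 ≤ L := le_ciInf fun n => norm_nonneg (f.comp (T n))
  have hLq : L ≤ q * L := le_of_forall_lt_imp_le_of_dense fun δ hδ =>
    ge_of_tendsto' (hlim.const_mul q) (h δ fun n => hδ.trans_le (ciInf_le hbdd n))
  rwa [show L = 0 by nlinarith] at hlim

end GlidingHump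

namespace MixedPre

variable {N : ℕ → ℕ}

lemma proj_empty : proj N ∅ = 0 :=
  ContinuousLinearMap.ext fun x => ext_coord fun i => by
    rw [coord_proj, Set.indicator_empty, zero_apply, map_zero]

lemma proj_Ici_sub_proj_Ici {m n : ℕ} (hmn : m ≤ n) :
    proj N (Set.Ici m) - proj N (Set.Ici n) = proj N (Set.Ico m n) := by
  refine ContinuousLinearMap.ext fun x => ext_coord fun i => ?_
  rw [sub_apply, map_sub, sub_eq_iff_eq_add]
  simp only [coord_proj, ← Set.Ico_union_Ici_eq_Ici hmn]
  exact Set.indicator_union_of_notMem_inter (by simp) _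

lemma eventually_proj_Ici_apply_eq_zero (x : MixedPre N) :
    ∀ᶠ n in atTop, proj N (Set.Ici n) x = 0 := by
  obtain ⟨m, hm⟩ := exists_coord_eq_zero x
  filter_upwards [eventually_ge_atTop m] with n hn
  refine ext_coord fun i => ?_
  rw [coord_proj, map_zero, Set.indicator_apply_eq_zero]
  exact fun hi => hm i (hn.trans hi)

lemma sum_norm_proj_proj_le_of_subsingleton {I : ℕ → Set ℕ} {B : Finset ℕ}
    {K : Set ℕ} (y : MixedPre N)
    (h : ∀ s ∈ B, ∀ t ∈ B, s < t → (I s ∩ K).Nonempty → ¬ (I t ∩ K).Nonempty) :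
    ∑ i ∈ B, ‖proj N (I i) (proj N K y)‖ ≤ ‖y‖ := by
  have hzero (i : ℕ) (hi : ¬ (I i ∩ K).Nonempty) : ‖proj N (I i) (proj N K y)‖ = 0 := by
    rw [proj_proj, Set.not_nonempty_iff_eq_empty.1 hi, proj_empty, zero_apply, norm_zero]
  by_cases hex : ∃ s ∈ B, (I s ∩ K).Nonempty
  · obtain ⟨s, hs, hsK⟩ := hex
    rw [Finset.sum_eq_single_of_mem s hs fun t ht hts => hzero t ?_]
    · exact (norm_proj_apply_le _ _).trans (norm_proj_apply_le _ _)
    · rcases hts.lt_or_gt with hlt | hlt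
      · exact fun htK => h t ht s hs hlt htK hsK
      · exact h s hs t ht hlt hsK
  · rw [Finset.sum_eq_zero fun i hi => hzero i fun hK => hex ⟨i, hi, hK⟩]
    exact norm_nonneg y

section Average

variable {I J : ℕ → Set ℕ} {B : Finset ℕ} {j : ℕ}

lemma half_pow_mul_sum_sum_norm_proj_proj_le (hB : B.card ≤ N j) (hI : IsSuccessive I)
    (hJ : IsSuccessive J) {y : ℕ → MixedPre N} (hy : ∀ b, ‖y b‖ ≤ 1) (r : ℕ) :
    (1 / 2) ^ (j + 1) * ∑ b ∈ Finset.range r, ∑ i ∈ B, ‖proj N (I i) (proj N (J b) (y b))‖ ≤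
      r / 2 + N j := by
  classical
  let meetsTwo (b : ℕ) : Prop :=
    ∃ s ∈ B, ∃ t ∈ B, s < t ∧ (I s ∩ J b).Nonempty ∧ (I t ∩ J b).Nonempty
  have hterm (b : ℕ) : (1 / 2) ^ (j + 1) * ∑ i ∈ B, ‖proj N (I i) (proj N (J b) (y b))‖ ≤
      1 / 2 + if meetsTwo b then 1 else 0 := by
    split_ifs with hb
    · have := half_pow_mul_sum_norm_proj_le hB hI (proj N (J b) (y b))
      linarith [norm_proj_apply_le (J b) (y b), hy b]
    · have hsum := sum_norm_proj_proj_le_of_subsingleton (B := B) (I := I) (K := J b) (y b)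
        fun s hs t ht hst hsJ htJ => hb ⟨s, hs, t, ht, hst, hsJ, htJ⟩
      rw [pow_succ, mul_assoc]
      refine (half_pow_mul_le (by positivity) j).trans ?_
      linarith [hy b]
  have hcard : (((Finset.range r).filter meetsTwo).card : ℝ) ≤ N j := by
    exact_mod_cast (hI.card_filter_le hJ B (Finset.range r)).trans hB
  rw [Finset.mul_sum]
  refine (Finset.sum_le_sum fun b _ => hterm b).trans ?_
  rw [Finset.sum_add_distrib, Finset.sum_const, Finset.card_range, nsmul_eq_mul,
    Finset.sum_boole]
  linarith

lemma half_pow_mul_sum_norm_proj_average_le (hB : B.card ≤ N j) (hI : IsSuccessive I)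
    (hJ : IsSuccessive J) {y : ℕ → MixedPre N} (hy : ∀ b, ‖y b‖ ≤ 1) {r : ℕ} (hr : 0 < r) :
    (1 / 2) ^ (j + 1) *
        ∑ i ∈ B, ‖proj N (I i) ((r : ℝ)⁻¹ • ∑ b ∈ Finset.range r, proj N (J b) (y b))‖ ≤
      1 / 2 + N j / r := by
  calc _ ≤ (1 / 2) ^ (j + 1) *
        ∑ i ∈ B, (r : ℝ)⁻¹ * ∑ b ∈ Finset.range r, ‖proj N (I i) (proj N (J b) (y b))‖ := by
        gcongr with i
        rw [map_smul, norm_smul, Real.norm_of_nonneg (by positivity), map_sum]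
        gcongr
        exact norm_sum_le _ _
    _ = (r : ℝ)⁻¹ * ((1 / 2) ^ (j + 1) *
        ∑ b ∈ Finset.range r, ∑ i ∈ B, ‖proj N (I i) (proj N (J b) (y b))‖) := by
        rw [← Finset.mul_sum, Finset.sum_comm, mul_left_comm]
    _ ≤ (r : ℝ)⁻¹ * (r / 2 + N j) := by
        gcongr
        exact half_pow_mul_sum_sum_norm_proj_proj_le hB hI hJ hy r
    _ = 1 / 2 + N j / r := by field_simp

end Average

lemma norm_inv_smul_sum_range_le {r : ℕ} {y : ℕ → MixedPre N} (hy : ∀ b, ‖y b‖ ≤ 1) :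
    ‖(r : ℝ)⁻¹ • ∑ b ∈ Finset.range r, y b‖ ≤ 1 := by
  rw [norm_smul, Real.norm_of_nonneg (by positivity)]
  refine (mul_le_mul_of_nonneg_left (norm_sum_le_of_le _ fun b _ => hy b) (by positivity)).trans ?_
  simpa using inv_mul_le_one

lemma abs_coord_add_le_one {S : Set ℕ} {x z : MixedPre N} (hx : ‖x‖ ≤ 1) (hz : ‖z‖ ≤ 1)
    (hxS : proj N S x = x) (hzS : proj N S z = 0) (i : ℕ) : |coord N i (x + z)| ≤ 1 := by
  rw [map_add]
  by_cases hi : i ∈ S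
  · have hzi : coord N i z = 0 := by
      rw [← Set.indicator_of_mem hi fun i => coord N i z, ← coord_proj, hzS, map_zero]
    rw [hzi, add_zero]
    exact (abs_coord_le i x).trans hx
  · have hxi : coord N i x = 0 := by rw [← hxS, coord_proj, Set.indicator_of_notMem hi]
    rw [hxi, zero_add]
    exact (abs_coord_le i z).trans hz

lemma half_pow_mul_sum_norm_proj_add_le (I : ℕ → Set ℕ) (B : Finset ℕ) (j : ℕ) (x z : MixedPre N) :
    (1 / 2) ^ j * ∑ i ∈ B, ‖proj N (I i) (x + z)‖ ≤
      (1 / 2) ^ j * ∑ i ∈ B, ‖proj N (I i) x‖ + (1 / 2) ^ j * ∑ i ∈ B, ‖proj N (I i) z‖ := by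
  rw [← mul_add, ← Finset.sum_add_distrib]
  gcongr with i
  rw [map_add]
  exact norm_add_le _ _

-- For large `j` the factor `2^{-(j+1)}` makes the contribution of the finitely supported `x` small,
-- for small `j` the long average contributes little more than `1 / 2`.
lemma exists_norm_add_average_le {x : MixedPre N} (hx : ‖x‖ ≤ 1) :
    ∃ r : ℕ, 0 < r ∧ ∀ (J : ℕ → Set ℕ) (y : ℕ → MixedPre N), IsSuccessive J →
      proj N (J 0) x = x → (∀ b, ‖y b‖ ≤ 1) →
      ‖x + (r : ℝ)⁻¹ • ∑ b ∈ Finset.range r, proj N (J (b + 1)) (y b)‖ ≤ 8 / 5 := by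
  obtain ⟨c, hc⟩ := exists_sum_norm_proj_le x
  obtain ⟨K, hK⟩ := exists_half_pow_mul_le c (by norm_num : (0 : ℝ) < 3 / 5)
  refine ⟨10 * ∑ j ∈ Finset.range K, N j + 1, Nat.succ_pos _, fun J y hJ hxJ hy => ?_⟩
  set r := 10 * ∑ j ∈ Finset.range K, N j + 1 with hr
  set z := (r : ℝ)⁻¹ • ∑ b ∈ Finset.range r, proj N (J (b + 1)) (y b) with hz
  have hz1 : ‖z‖ ≤ 1 := norm_inv_smul_sum_range_le fun b => (norm_proj_apply_le _ _).trans (hy b)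
  have hzJ : proj N (J 0) z = 0 := by
    simp only [hz, map_smul, map_sum, proj_proj, (hJ.disjoint (Nat.succ_ne_zero _).symm).inter_eq,
      proj_empty, zero_apply, Finset.sum_const_zero, smul_zero]
  refine norm_le_of_average_le (fun i => ?_) fun j B I hB hI => ?_
  · exact (abs_coord_add_le_one hx hz1 hxJ hzJ i).trans (by norm_num)
  have hxB := half_pow_mul_sum_norm_proj_le hB hI x
  have hzB := half_pow_mul_sum_norm_proj_le hB hI z
  refine (half_pow_mul_sum_norm_proj_add_le I B (j + 1) x z).trans ?_
  rcases lt_or_ge j K with hj | hj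
  · have hNj : (N j : ℝ) / r ≤ 1 / 10 := by
      have : N j ≤ _ := Finset.single_le_sum_of_canonicallyOrdered (Finset.mem_range.2 hj)
      have : (10 * N j : ℝ) ≤ r := by exact_mod_cast (by omega : 10 * N j ≤ r)
      rw [div_le_iff₀ (by positivity)]
      linarith
    have := half_pow_mul_sum_norm_proj_average_le hB hI (J := fun b => J (b + 1))
      (fun s t hst => hJ _ _ (Nat.succ_lt_succ hst)) hy (hr ▸ Nat.succ_pos _ : 0 < r)
    linarith
  · have : (1 / 2) ^ (j + 1) * ∑ i ∈ B, ‖proj N (I i) x‖ ≤ (1 / 2) ^ K * c :=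
      mul_le_mul (pow_le_pow_of_le_one (by norm_num) (by norm_num) (by omega)) (hc B I hI)
        (by positivity) (by positivity)
    linarith

lemma two_mul_le_norm_comp_proj_Ici {f : StrongDual ℝ (MixedPre N)} {δ : ℝ}
    (hδ : ∀ n, δ < ‖f.comp (proj N (Set.Ici n))‖) (n : ℕ) :
    2 * δ ≤ ‖f.comp (proj N (Set.Ici n))‖ * (8 / 5) := by
  obtain ⟨u, m, hm, hm0, hu⟩ := exists_gliding_hump (fun x => tendsto_const_nhds.congr'
    ((eventually_proj_Ici_apply_eq_zero x).mono fun _ => Eq.symm)) hδ n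
  let J (i : ℕ) : Set ℕ := Set.Ico (m i) (m (i + 1))
  have hfu (i : ℕ) : δ < f (proj N (J i) (u i)) := by
    rw [← proj_Ici_sub_proj_Ici (hm i.lt_succ_self).le]
    exact (hu i).2
  obtain ⟨r, hr, hnorm⟩ :=
    exists_norm_add_average_le ((norm_proj_apply_le (J 0) (u 0)).trans (hu 0).1)
  specialize hnorm J (fun b => u (b + 1)) (.Ico hm.monotone)
    (by rw [proj_proj, Set.inter_self]) fun b => (hu _).1
  set w := proj N (J 0) (u 0) +
    (r : ℝ)⁻¹ • ∑ b ∈ Finset.range r, proj N (J (b + 1)) (u (b + 1)) with hw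
  have hlower : δ + δ ≤ f w := by
    rw [hw, map_add, map_smul, map_sum, smul_eq_mul]
    refine add_le_add (hfu 0).le ?_
    rw [le_inv_mul_iff₀ (Nat.cast_pos.2 hr)]
    simpa using Finset.card_nsmul_le_sum (Finset.range r) _ _ fun b _ => (hfu (b + 1)).le
  have hself : proj N (Set.Ici n) w = w := by
    have hJ (i : ℕ) : Set.Ici n ∩ J i = J i := Set.inter_eq_self_of_subset_right fun a ha =>
      hm0.symm.le.trans ((hm.monotone i.zero_le).trans ha.1)
    simp only [hw, map_add, map_smul, map_sum, proj_proj, hJ]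
  calc 2 * δ ≤ f.comp (proj N (Set.Ici n)) w := by
        rwa [ContinuousLinearMap.comp_apply, hself, two_mul]
    _ ≤ ‖f.comp (proj N (Set.Ici n))‖ * (8 / 5) :=
        (le_abs_self _).trans ((f.comp (proj N (Set.Ici n))).le_opNorm_of_le hnorm)

lemma norm_proj_le (S : Set ℕ) : ‖proj N S‖ ≤ 1 :=
  (proj N S).opNorm_le_bound zero_le_one fun x => (norm_proj_apply_le S x).trans_eq (one_mul _).symm

lemma proj_Ici_comp_proj_Ici {m n : ℕ} (hmn : m ≤ n) :
    (proj N (Set.Ici m)).comp (proj N (Set.Ici n)) = proj N (Set.Ici n) :=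
  ContinuousLinearMap.ext fun x => by
    rw [ContinuousLinearMap.comp_apply, proj_proj,
      Set.inter_eq_self_of_subset_right (Set.Ici_subset_Ici.2 hmn)]

theorem tendsto_norm_comp_proj_Ici (f : StrongDual ℝ (MixedPre N)) :
    Tendsto (fun n => ‖f.comp (proj N (Set.Ici n))‖) atTop (𝓝 0) :=
  tendsto_norm_comp_zero (fun _ => norm_proj_le _) (fun _ _ => proj_Ici_comp_proj_Ici)
    (by norm_num : (4 / 5 : ℝ) < 1) fun δ hδ n => by linarith [two_mul_le_norm_comp_proj_Ici hδ n]

end MixedPre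

-- Both `F` and the evaluation at its restriction to `E` are continuous on the bidual of `E`, and
-- they agree on the image of `E`.
lemma isReflexiveSpace_dual_of_denseRange {E : Type*} [NormedAddCommGroup E] [NormedSpace ℝ E]
    (h : DenseRange (NormedSpace.inclusionInDoubleDual ℝ E)) :
    IsReflexiveSpace (StrongDual ℝ E) := by
  intro F
  let f : StrongDual ℝ E := F.comp (NormedSpace.inclusionInDoubleDual ℝ E)
  refine ⟨f, ContinuousLinearMap.ext fun G => ?_⟩
  exact congrFun (h.equalizer (NormedSpace.inclusionInDoubleDual ℝ _ f).continuous F.continuous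
    rfl) G

namespace MixedPre

variable {N : ℕ → ℕ}

lemma norm_sum_smul_comp_proj_le {f : ℕ → StrongDual ℝ (MixedPre N)} (hf : ∀ i, ‖f i‖ ≤ 1)
    {I : ℕ → Set ℕ} {B : Finset ℕ} {a : ℕ → ℝ} {c : ℝ} (hc : 0 ≤ c)
    (h : ∀ x, ∑ i ∈ B, |a i| * ‖proj N (I i) x‖ ≤ c * ‖x‖) :
    ‖∑ i ∈ B, a i • (f i).comp (proj N (I i))‖ ≤ c := by
  refine ContinuousLinearMap.opNorm_le_bound _ hc fun x => le_trans ?_ (h x)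
  rw [sum_apply]
  refine norm_sum_le_of_le _ fun i _ => ?_
  rw [smul_apply, norm_smul, Real.norm_eq_abs, ContinuousLinearMap.comp_apply]
  gcongr
  exact ((f i).le_of_opNorm_le (hf i) _).trans_eq (one_mul _)

lemma sub_proj_Ici_apply (n : ℕ) (x : MixedPre N) :
    x - proj N (Set.Ici n) x = ∑ i ∈ Finset.range n, coord N i x • unit N i := by
  refine ext_coord fun i => ?_
  simp only [map_sub, map_sum, map_smul, coord_proj, coord_unit, smul_eq_mul, mul_ite, mul_one,
    mul_zero, Finset.sum_ite_eq', Finset.mem_range, Set.indicator_apply, Set.mem_Ici]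
  rcases lt_or_ge i n with h | h
  · rw [if_neg h.not_ge, if_pos h, sub_zero]
  · rw [if_pos h, if_neg h.not_gt, sub_self]

lemma sub_comp_proj_Ici (f : StrongDual ℝ (MixedPre N)) (n : ℕ) :
    f - f.comp (proj N (Set.Ici n)) = ∑ i ∈ Finset.range n, f (unit N i) • coord N i := by
  ext x
  rw [sub_apply, ContinuousLinearMap.comp_apply, ← map_sub, sub_proj_Ici_apply, map_sum, sum_apply]
  exact Finset.sum_congr rfl fun i _ => by
    rw [map_smul, smul_apply, smul_eq_mul, smul_eq_mul, mul_comm]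

/-- The adjoint `f ↦ f ∘ P_n` of the projection `P_n` onto the coordinates from `n` on. -/
noncomputable def dualTail (N : ℕ → ℕ) (n : ℕ) :
    StrongDual ℝ (MixedPre N) →L[ℝ] StrongDual ℝ (MixedPre N) :=
  (proj N (Set.Ici n)).precomp ℝ

lemma dualTail_apply (n : ℕ) (f : StrongDual ℝ (MixedPre N)) :
    dualTail N n f = f.comp (proj N (Set.Ici n)) := rfl

lemma norm_dualTail_le (n : ℕ) : ‖dualTail N n‖ ≤ 1 :=
  (dualTail N n).opNorm_le_bound zero_le_one fun f => by
    rw [one_mul]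
    exact norm_comp_proj_le f _

lemma dualTail_comp_dualTail {m n : ℕ} (hmn : m ≤ n) :
    (dualTail N m).comp (dualTail N n) = dualTail N n := by
  ext f x
  simp only [ContinuousLinearMap.comp_apply, dualTail_apply, proj_proj,
    Set.inter_eq_self_of_subset_left (Set.Ici_subset_Ici.2 hmn)]

lemma dualTail_sub_dualTail {m n : ℕ} (hmn : m ≤ n) (f : StrongDual ℝ (MixedPre N)) :
    dualTail N m f - dualTail N n f = f.comp (proj N (Set.Ico m n)) := by
  rw [dualTail_apply, dualTail_apply, ← ContinuousLinearMap.comp_sub, proj_Ici_sub_proj_Ici hmn]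

-- `4 ^ j` successive functionals in the unit ball have a sum of norm at most `2 ^ (j + 1)`.
lemma nonpos_of_forall_lt_norm_comp_dualTail (hN : ∀ j, 4 ^ j ≤ N j)
    {G : StrongDual ℝ (StrongDual ℝ (MixedPre N))} {δ : ℝ}
    (hδ : ∀ n, δ < ‖G.comp (dualTail N n)‖) : δ ≤ 0 := by
  obtain ⟨ψ, m, hm, -, hψ⟩ := exists_gliding_hump
    (fun f => tendsto_zero_iff_norm_tendsto_zero.2 (tendsto_norm_comp_proj_Ici f)) hδ 0
  simp only [dualTail_sub_dualTail (hm (Nat.lt_succ_self _)).le] at hψ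
  have hblock (j : ℕ) : ‖∑ i ∈ Finset.range (4 ^ j),
      (1 : ℝ) • (ψ i).comp (proj N (Set.Ico (m i) (m (i + 1))))‖ ≤ 2 ^ (j + 1) :=
    norm_sum_smul_comp_proj_le (a := fun _ => 1) (fun i => (hψ i).1) (by positivity) fun x => by
      simpa using sum_norm_proj_le (by simpa using hN j) (.Ico hm.monotone) x
  have hle (j : ℕ) : 4 ^ j * δ ≤ ‖G‖ * 2 ^ (j + 1) :=
    calc 4 ^ j * δ
        ≤ ∑ i ∈ Finset.range (4 ^ j), G ((ψ i).comp (proj N (Set.Ico (m i) (m (i + 1))))) := by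
          simpa using Finset.card_nsmul_le_sum (Finset.range (4 ^ j)) _ _ fun i _ => (hψ i).2.le
      _ = G (∑ i ∈ Finset.range (4 ^ j),
            (1 : ℝ) • (ψ i).comp (proj N (Set.Ico (m i) (m (i + 1))))) := by
          simp only [one_smul, map_sum]
      _ ≤ ‖G‖ * 2 ^ (j + 1) := (le_abs_self _).trans (G.le_opNorm_of_le (hblock j))
  have hlim : Tendsto (fun j : ℕ => ‖G‖ * 2 * (1 / 2) ^ j) atTop (𝓝 0) := by
    simpa using (tendsto_pow_atTop_nhds_zero_of_lt_one (r := (1 / 2 : ℝ)) (by norm_num)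
      (by norm_num)).const_mul (‖G‖ * 2)
  refine ge_of_tendsto' hlim fun j => ?_
  refine le_of_mul_le_mul_left ((hle j).trans_eq ?_) (by positivity : (0 : ℝ) < 4 ^ j)
  rw [mul_left_comm, ← mul_pow, pow_succ]
  norm_num
  ring

theorem tendsto_norm_comp_dualTail (hN : ∀ j, 4 ^ j ≤ N j)
    (G : StrongDual ℝ (StrongDual ℝ (MixedPre N))) :
    Tendsto (fun n => ‖G.comp (dualTail N n)‖) atTop (𝓝 0) :=
  tendsto_norm_comp_zero norm_dualTail_le (fun _ _ => dualTail_comp_dualTail) zero_lt_one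
    fun δ hδ n => by simpa using nonpos_of_forall_lt_norm_comp_dualTail hN hδ

lemma isWeaklyNull_coord (hN : ∀ j, 4 ^ j ≤ N j) : IsWeaklyNull (coord N) := fun G => by
  refine squeeze_zero_norm (fun n => ?_) (tendsto_norm_comp_dualTail hN G)
  have h : dualTail N n (coord N n) = coord N n := by
    ext x
    rw [dualTail_apply, ContinuousLinearMap.comp_apply, coord_proj,
      Set.indicator_of_mem Set.self_mem_Ici]
  simpa [h, norm_coord] using (G.comp (dualTail N n)).le_opNorm (coord N n)

lemma sub_inclusionInDoubleDual_sum (G : StrongDual ℝ (StrongDual ℝ (MixedPre N))) (n : ℕ) :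
    G - NormedSpace.inclusionInDoubleDual ℝ (MixedPre N)
      (∑ i ∈ Finset.range n, G (coord N i) • unit N i) = G.comp (dualTail N n) := by
  ext f
  rw [sub_apply, NormedSpace.dual_def, ContinuousLinearMap.comp_apply, dualTail_apply,
    ← sub_sub_cancel f (f.comp (proj N (Set.Ici n))), sub_comp_proj_Ici]
  simp only [map_sub, map_sum, map_smul, smul_eq_mul, mul_comm]

theorem isReflexiveSpace_dual (hN : ∀ j, 4 ^ j ≤ N j) :
    IsReflexiveSpace (StrongDual ℝ (MixedPre N)) := by
  refine isReflexiveSpace_dual_of_denseRange fun G => ?_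
  have hlim : Tendsto (fun n => NormedSpace.inclusionInDoubleDual ℝ (MixedPre N)
      (∑ i ∈ Finset.range n, G (coord N i) • unit N i)) atTop (𝓝 G) := by
    refine (tendsto_iff_norm_sub_tendsto_zero
      (E := StrongDual ℝ (StrongDual ℝ (MixedPre N)))).2 ?_
    simpa only [norm_sub_rev _ G, sub_inclusionInDoubleDual_sum] using
      tendsto_norm_comp_dualTail hN G
  exact mem_closure_of_tendsto hlim (.of_forall fun n => Set.mem_range_self _)

lemma exists_norm_sub_comp_proj_Ico_le {f : ℕ → StrongDual ℝ (MixedPre N)}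
    (hf : IsWeaklyNull f) (k m : ℕ) {ε : ℝ} (hε : 0 < ε) :
    ∃ k' m', k < k' ∧ m ≤ m' ∧ ‖f k' - (f k').comp (proj N (Set.Ico m m'))‖ ≤ ε := by
  have hhead : Tendsto (fun k => ‖f k - (f k).comp (proj N (Set.Ici m))‖) atTop (𝓝 0) := by
    refine tendsto_zero_iff_norm_tendsto_zero.1 ?_
    simp only [sub_comp_proj_Ici]
    rw [← Finset.sum_const_zero (s := Finset.range m)]
    refine tendsto_finsetSum _ fun i _ => ?_
    simpa only [NormedSpace.dual_def, zero_smul] using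
      (hf (NormedSpace.inclusionInDoubleDual ℝ _ (unit N i))).smul_const (coord N i)
  obtain ⟨k', hk', hkk'⟩ :=
    ((hhead.eventually_le_const (half_pos hε)).and (eventually_gt_atTop k)).exists
  obtain ⟨m', hm', hmm'⟩ := (((tendsto_norm_comp_proj_Ici (f k')).eventually_le_const
    (half_pos hε)).and (eventually_ge_atTop m)).exists
  refine ⟨k', m', hkk', hmm', ?_⟩
  rw [← proj_Ici_sub_proj_Ici hmm', ContinuousLinearMap.comp_sub, ← sub_add]
  linarith [norm_add_le (f k' - (f k').comp (proj N (Set.Ici m)))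
    ((f k').comp (proj N (Set.Ici m')))]

lemma exists_subseq_norm_sub_comp_proj_le {f : ℕ → StrongDual ℝ (MixedPre N)}
    (hf : IsWeaklyNull f) :
    ∃ (k : ℕ → ℕ) (I : ℕ → Set ℕ), StrictMono k ∧ IsSuccessive I ∧
      ∀ i, ‖f (k i) - (f (k i)).comp (proj N (I i))‖ ≤ (1 / 2) ^ i := by
  have hstep (s : ℕ × ℕ) : ∃ t : ℕ × ℕ, s.1 < t.1 ∧ s.2 ≤ t.2 ∧
      ‖f t.1 - (f t.1).comp (proj N (Set.Ico s.2 t.2))‖ ≤ (1 / 2) ^ s.1 := by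
    obtain ⟨k, m, hkm⟩ := exists_norm_sub_comp_proj_Ico_le hf s.1 s.2
      (by positivity : (0 : ℝ) < (1 / 2) ^ s.1)
    exact ⟨(k, m), hkm⟩
  choose next hk hm hclose using hstep
  let s (i : ℕ) : ℕ × ℕ := next^[i] (0, 0)
  have hs (i : ℕ) : s (i + 1) = next (s i) := Function.iterate_succ_apply' next i (0, 0)
  have hk' : StrictMono fun i => (s i).1 := strictMono_nat_of_lt_succ fun i => hs i ▸ hk (s i)
  have hm' : Monotone fun i => (s i).2 := monotone_nat_of_le_succ fun i => hs i ▸ hm (s i)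
  refine ⟨fun i => (s (i + 1)).1, fun i => Set.Ico (s i).2 (s (i + 1)).2,
    fun _ _ hij => hk' (Nat.succ_lt_succ hij), .Ico hm', fun i => ?_⟩
  simp only [hs]
  exact (hclose (s i)).trans (pow_le_pow_of_le_one (by norm_num) (by norm_num) (hk'.le_apply))

-- The coordinates with `(1 / 4) ^ (j + 1) < |a i| ≤ (1 / 4) ^ j` contribute at most
-- `(1 / 4) ^ j * 2 ^ (j + 1) * ‖x‖`.
lemma sum_abs_mul_norm_proj_le {I : ℕ → Set ℕ} (hI : IsSuccessive I) {a : ℕ →₀ ℝ}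
    (ha1 : ∀ i, |a i| ≤ 1)
    (ha : ∀ j, (a.support.filter fun i => (1 / 4 : ℝ) ^ (j + 1) < |a i|).card ≤ N j)
    (x : MixedPre N) : ∑ i ∈ a.support, |a i| * ‖proj N (I i) x‖ ≤ 4 * ‖x‖ := by
  choose! level hlt hle using fun i (hi : i ∈ a.support) => exists_nat_pow_near_of_lt_one
    (abs_pos.2 (Finsupp.mem_support_iff.1 hi)) (ha1 i) (by norm_num : (0 : ℝ) < 1 / 4)
    (by norm_num)
  have hlayer (j : ℕ) : ∑ i ∈ a.support with level i = j, |a i| * ‖proj N (I i) x‖ ≤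
      (1 / 2) ^ j * (2 * ‖x‖) := by
    have hcard : (a.support.filter fun i => level i = j).card ≤ N j :=
      (Finset.card_le_card (Finset.monotone_filter_right _ fun i hi h => h ▸ hlt i hi)).trans (ha j)
    calc _ ≤ ∑ i ∈ a.support with level i = j, (1 / 4) ^ j * ‖proj N (I i) x‖ := by
          refine Finset.sum_le_sum fun i hi => ?_
          obtain ⟨hsupp, rfl⟩ := Finset.mem_filter.1 hi
          exact mul_le_mul_of_nonneg_right (hle i hsupp) (norm_nonneg _)
      _ ≤ (1 / 4) ^ j * (2 ^ (j + 1) * ‖x‖) := by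
          rw [← Finset.mul_sum]
          gcongr
          exact sum_norm_proj_le hcard hI x
      _ = (1 / 2) ^ j * (2 * ‖x‖) := by
          rw [pow_succ, ← mul_assoc, ← mul_assoc, ← mul_pow]
          norm_num
          ring
  calc _ = ∑ j ∈ a.support.image level,
        ∑ i ∈ a.support with level i = j, |a i| * ‖proj N (I i) x‖ :=
        (Finset.sum_fiberwise_of_maps_to (fun i => Finset.mem_image_of_mem level) _).symm
    _ ≤ ∑ j ∈ a.support.image level, (1 / 2) ^ j * (2 * ‖x‖) :=
        Finset.sum_le_sum fun j _ => hlayer j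
    _ ≤ 2 * (2 * ‖x‖) := by
        rw [← Finset.sum_mul]
        gcongr
        exact (summable_geometric_two.sum_le_tsum _ fun j _ => by positivity).trans_eq
          tsum_geometric_two
    _ = 4 * ‖x‖ := by ring

theorem hasU_dual {V : Type*} [NormedAddCommGroup V] [NormedSpace ℝ V] {v : ℕ → V}
    (h : IsOneSuppressionUnconditional v) (hn : IsNormalized v)
    (hN : ∀ (j : ℕ) (a : ℕ →₀ ℝ), ‖Finsupp.linearCombination ℝ v a‖ ≤ 1 →
      (a.support.filter fun i => (1 / 4 : ℝ) ^ (j + 1) < |a i|).card ≤ N j) :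
    HasU v (StrongDual ℝ (MixedPre N)) := by
  refine ⟨2 + 4, fun f hf hf0 => ?_⟩
  obtain ⟨k, I, hk, hI, hclose⟩ := exists_subseq_norm_sub_comp_proj_le hf0
  refine ⟨k, hk, fun a ha => ?_⟩
  have ha1 (i : ℕ) : |a i| ≤ 1 := (h.abs_le_norm hn a i).trans ha
  have hblocks : ‖∑ i ∈ a.support, a i • (f (k i)).comp (proj N (I i))‖ ≤ 4 :=
    norm_sum_smul_comp_proj_le (fun i => (hf (k i)).le) zero_le_four
      (sum_abs_mul_norm_proj_le hI ha1 fun j => hN j a ha)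
  have hrest : ‖∑ i ∈ a.support, a i • (f (k i) - (f (k i)).comp (proj N (I i)))‖ ≤ 2 := by
    refine (norm_sum_le_of_le _ fun i _ => ?_).trans
      ((summable_geometric_two.sum_le_tsum a.support fun i _ => by positivity).trans_eq
        tsum_geometric_two)
    rw [norm_smul]
    exact (mul_le_of_le_one_left (norm_nonneg _) (ha1 i)).trans (hclose i)
  have hsplit : Finsupp.linearCombination ℝ (f ∘ k) a =
      ∑ i ∈ a.support, a i • (f (k i) - (f (k i)).comp (proj N (I i))) +
        ∑ i ∈ a.support, a i • (f (k i)).comp (proj N (I i)) := by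
    simp only [smul_sub, Finset.sum_sub_distrib, sub_add_cancel]
    rfl
  rw [hsplit]
  exact norm_add_le_of_le hrest hblocks

lemma proj_sum_unit (S : Set ℕ) [DecidablePred (· ∈ S)] (A : Finset ℕ) :
    proj N S (∑ i ∈ A, unit N i) = ∑ i ∈ A with i ∈ S, unit N i := by
  refine ext_coord fun i => ?_
  by_cases hi : i ∈ S <;> simp [coord_proj, coord_unit, hi]

lemma norm_sum_unit_le_card (A : Finset ℕ) : ‖∑ i ∈ A, unit N i‖ ≤ A.card :=
  IsNormalized.norm_sum_le_card norm_unit A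

lemma abs_coord_sum_unit_le_one (A : Finset ℕ) (i : ℕ) :
    |coord N i (∑ a ∈ A, unit N a)| ≤ 1 := by
  simp only [map_sum, coord_unit, Finset.sum_ite_eq']
  split_ifs <;> simp

lemma sum_norm_proj_sum_unit_le {I : ℕ → Set ℕ} (hI : IsSuccessive I) {q c : ℝ} (hq : 0 ≤ q)
    (h : ∀ A : Finset ℕ, ‖∑ a ∈ A, unit N a‖ ≤ q * A.card + c) (A B : Finset ℕ) :
    ∑ i ∈ B, ‖proj N (I i) (∑ a ∈ A, unit N a)‖ ≤ q * A.card + c * B.card := by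
  classical
  simp only [proj_sum_unit]
  calc ∑ i ∈ B, ‖∑ a ∈ A with a ∈ I i, unit N a‖
      ≤ ∑ i ∈ B, (q * (A.filter (· ∈ I i)).card + c) := Finset.sum_le_sum fun i _ => h _
    _ = q * ∑ i ∈ B, ((A.filter (· ∈ I i)).card : ℝ) + c * B.card := by
        rw [Finset.sum_add_distrib, ← Finset.mul_sum, Finset.sum_const, nsmul_eq_mul, mul_comm c]
    _ ≤ q * A.card + c * B.card := by
        gcongr
        exact hI.sum_card_filter_le A B

-- A functional of level `j ≤ m` halves the bound for `m` on each of its at most `N j` pieces; one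
-- of level `j > m` has the factor `2^{-(j+1)} ≤ 2^{-(m+1)}`.
lemma exists_norm_sum_unit_le (m : ℕ) : ∃ c : ℝ, 0 ≤ c ∧ ∀ A : Finset ℕ,
    ‖∑ i ∈ A, unit N i‖ ≤ (1 / 2) ^ m * A.card + c := by
  induction m with
  | zero => exact ⟨0, le_rfl, fun A => by simpa using norm_sum_unit_le_card A⟩
  | succ m ih =>
    obtain ⟨c, hc, h⟩ := ih
    set s := ∑ j ∈ Finset.range (m + 1), N j
    have hcs : 0 ≤ c * s := by positivity
    refine ⟨1 + c * s, by positivity, fun A => norm_le_of_average_le (fun i => ?_)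
      fun j B I hB hI => ?_⟩
    · have : 0 ≤ (1 / 2 : ℝ) ^ (m + 1) * A.card := by positivity
      linarith [abs_coord_sum_unit_le_one (N := N) A i]
    rcases lt_or_ge j (m + 1) with hj | hj
    · have hBs : (B.card : ℝ) ≤ s := Nat.cast_le.2 <| hB.trans <|
        Finset.single_le_sum_of_canonicallyOrdered (f := N) (Finset.mem_range.2 hj)
      calc (1 / 2) ^ (j + 1) * ∑ i ∈ B, ‖proj N (I i) (∑ a ∈ A, unit N a)‖
          ≤ 1 / 2 * ((1 / 2) ^ m * A.card + c * B.card) := by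
            gcongr
            · exact pow_le_of_le_one (by norm_num) (by norm_num) j.succ_ne_zero
            · exact sum_norm_proj_sum_unit_le hI (by positivity) h A B
        _ ≤ 1 / 2 * ((1 / 2) ^ m * A.card + c * s) := by gcongr
        _ ≤ (1 / 2) ^ (m + 1) * A.card + (1 + c * s) := by
            rw [pow_succ]
            linarith
    · calc (1 / 2) ^ (j + 1) * ∑ i ∈ B, ‖proj N (I i) (∑ a ∈ A, unit N a)‖
          ≤ (1 / 2) ^ (m + 1) * (1 * A.card + 0 * B.card) := by
            gcongr ?_ * ?_
            · exact pow_le_pow_of_le_one (by norm_num) (by norm_num) (by omega)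
            · exact sum_norm_proj_sum_unit_le hI zero_le_one
                (by simpa using norm_sum_unit_le_card) A B
        _ ≤ (1 / 2) ^ (m + 1) * A.card + (1 + c * s) := by linarith

lemma card_le_norm_sum_coord_mul_norm_sum_unit (A : Finset ℕ) :
    (A.card : ℝ) ≤ ‖∑ i ∈ A, coord N i‖ * ‖∑ i ∈ A, unit N i‖ := by
  have h : (∑ i ∈ A, coord N i) (∑ i ∈ A, unit N i) = A.card := by
    simp [sum_apply, coord_unit]
  exact h ▸ (le_abs_self _).trans ((∑ i ∈ A, coord N i).le_opNorm _)

lemma not_hasLongBoundedSums_coord : ¬ HasLongBoundedSums (coord N) := by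
  rintro ⟨K, hK⟩
  have hK0 : 0 ≤ K := (hK 0).elim fun A hA => (norm_nonneg _).trans hA.2
  obtain ⟨m, hm⟩ := exists_half_pow_mul_le K one_half_pos
  obtain ⟨c, -, hc⟩ := exists_norm_sum_unit_le (N := N) m
  obtain ⟨n, hn⟩ := exists_nat_gt (2 * (K * c))
  obtain ⟨A, hnA, hA⟩ := hK n
  have hcard : (A.card : ℝ) ≤ K * ((1 / 2) ^ m * A.card + c) :=
    (card_le_norm_sum_coord_mul_norm_sum_unit A).trans
      (mul_le_mul hA (hc A) (norm_nonneg _) hK0)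
  have hhalf : (1 / 2) ^ m * K * A.card ≤ 1 / 2 * A.card := by gcongr
  have hnA' : (n : ℝ) ≤ A.card := Nat.cast_le.2 hnA
  linarith

theorem not_hasU_dual {W : Type*} [NormedAddCommGroup W] [NormedSpace ℝ W] {w : ℕ → W}
    (hw : HasLongBoundedSums w) (hN : ∀ j, 4 ^ j ≤ N j) :
    ¬ HasU w (StrongDual ℝ (MixedPre N)) := by
  rintro ⟨C, hC⟩
  obtain ⟨k, hk, hdom⟩ := hC (coord N) norm_coord (isWeaklyNull_coord hN)
  exact not_hasLongBoundedSums_coord ((hw.of_dominates ⟨C, hdom⟩).of_comp hk.injective)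

end MixedPre

-- `A` is the union of `#A` admissible singletons.
lemma sum_abs_le_two_mul_tsirelsonNorm {A : Finset ℕ} (hA : ∀ a ∈ A, A.card ≤ a + 1)
    (x : ℕ →₀ ℝ) : ∑ i ∈ A, |x i| ≤ 2 * tsirelsonNorm x := by
  let e := A.orderEmbOfFin rfl
  have hadm : (1 / 2 : ℝ) * ∑ t, tsirelsonNorm (x.filter (· ∈ ({e t} : Finset ℕ))) ≤
      tsirelsonNorm x := by
    refine (isTsirelsonNorm_tsirelsonNorm x).1 (.inr ⟨A.card, fun t => {e t}, ⟨?_, ?_⟩, rfl⟩)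
    · simpa only [Finset.mem_singleton, forall_eq] using
        fun t => hA _ (A.orderEmbOfFin_mem rfl t)
    · simpa only [Finset.mem_singleton, forall_eq] using fun s t hst => e.strictMono hst
  calc ∑ i ∈ A, |x i| = ∑ t, |x (e t)| := by
        conv_lhs => rw [← Finset.map_orderEmbOfFin_univ A rfl, Finset.sum_map]
        rfl
    _ ≤ ∑ t, tsirelsonNorm (x.filter (· ∈ ({e t} : Finset ℕ))) := by
        refine Finset.sum_le_sum fun t _ => ?_
        rw [← Finsupp.filter_apply_pos (· ∈ ({e t} : Finset ℕ)) x (Finset.mem_singleton_self _)]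
        exact abs_coord_le_tsirelsonNorm _ (e t)
    _ ≤ 2 * tsirelsonNorm x := by linarith

lemma norm_sum_tsirelsonDualBasis_le {A : Finset ℕ} (hA : ∀ a ∈ A, A.card ≤ a + 1) :
    ‖∑ i ∈ A, tsirelsonDualBasis i‖ ≤ 2 := by
  refine ContinuousLinearMap.opNorm_le_bound _ zero_le_two fun x => ?_
  induction x using UniformSpace.Completion.induction_on with
  | hp => exact isClosed_le (by fun_prop) (by fun_prop)
  | ih x =>
    rw [UniformSpace.Completion.norm_coe, sum_apply]
    rw [Finset.sum_congr rfl fun i _ => tsirelsonDualBasis_coe i x]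
    exact (Finset.abs_sum_le_sum_abs _ _).trans (sum_abs_le_two_mul_tsirelsonNorm hA x)

lemma hasLongBoundedSums_tsirelsonDualBasis : HasLongBoundedSums tsirelsonDualBasis := by
  refine ⟨2, fun n => ⟨Finset.Ico n (n + n), by simp, norm_sum_tsirelsonDualBasis_le
    fun a ha => ?_⟩⟩
  rw [Nat.card_Ico, Nat.add_sub_cancel]
  exact (Finset.mem_Ico.1 ha).1.trans a.le_succ

end UpperEstimate

theorem lemma5p7_general {V W : Type*} [NormedAddCommGroup V] [NormedSpace ℝ V]
    [NormedAddCommGroup W] [NormedSpace ℝ W] {v : ℕ → V} {w : ℕ → W}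
    (hnorm : UpperEstimate.IsNormalized v)
    (huncond : UpperEstimate.IsOneSuppressionUnconditional v)
    (hv : ¬ UpperEstimate.HasLongBoundedSums v) (hw : UpperEstimate.HasLongBoundedSums w) :
    ∃ (X : Type) (_ : NormedAddCommGroup X) (_ : NormedSpace ℝ X) (_ : CompleteSpace X),
      UpperEstimate.IsReflexiveSpace X ∧ UpperEstimate.HasU v X ∧ ¬ UpperEstimate.HasU w X := by
  choose M hM using fun j : ℕ =>
    huncond.exists_card_filter_le hv (by positivity : (0 : ℝ) < (1 / 4) ^ (j + 1))
  let N (j : ℕ) : ℕ := max (4 ^ j) (M j)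
  have hN (j : ℕ) : 4 ^ j ≤ N j := le_max_left _ _
  exact ⟨StrongDual ℝ (UpperEstimate.MixedPre N), inferInstance, inferInstance, inferInstance,
    UpperEstimate.MixedPre.isReflexiveSpace_dual hN,
    UpperEstimate.MixedPre.hasU_dual huncond hnorm fun j a ha =>
      (hM j a ha).trans (le_max_right _ _),
    UpperEstimate.MixedPre.not_hasU_dual hw hN⟩

theorem lemma5p7 {V : Type*} [NormedAddCommGroup V] [NormedSpace ℝ V] [CompleteSpace V]
    (v : ℕ → V)
    (hbasic : UpperEstimate.IsBasicSequence v)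
    (hnorm : UpperEstimate.IsNormalized v)
    (huncond : UpperEstimate.IsOneSuppressionUnconditional v)
    (hsub : ∀ k : ℕ → ℕ, StrictMono k → UpperEstimate.Dominates (v ∘ k) v)
    (hc0 : ¬ UpperEstimate.IsEquivalentTo v UpperEstimate.c0Basis) :
    ∃ (X : Type) (_ : NormedAddCommGroup X) (_ : NormedSpace ℝ X) (_ : CompleteSpace X),
      UpperEstimate.IsReflexiveSpace X ∧
      UpperEstimate.HasU v X ∧
      ¬ UpperEstimate.HasU UpperEstimate.tsirelsonDualBasis X :=
  lemma5p7_general hnorm huncond (huncond.not_hasLongBoundedSums hnorm hsub hc0)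
    UpperEstimate.hasLongBoundedSums_tsirelsonDualBasis
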